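/- Let $(\Omega,\mathcal F,\mathbb P)$ be a probability space, and let $\alpha\in[0,1]$ and $2\le p<\infty$. For a sequence $f=(f_n)_{n\ge0}$ of real random variables put $df_0=f_0$, $df_{n+1}=f_{n+1}-f_n$, $f^*=\sup_{n\ge0}|f_n|$ and $\|f\|_p=\sup_{n\ge 0}\|f_n\|_p$; these quantities and $\|f^*\|_p$ may be infinite. Call $(f,g)$ an admissible pair for a filtration $(\mathcal F_n)_{n\ge0}$ if $f$ is a non-negative submartingale, $g$ is a real-valued adapted integrable process, and $g$ is $\alpha$-strongly subordinate to $f$, that is, for all $n\ge0$, almost surely, $$|dg_n|\le|df_n|\quad\text{and}\quad|\mathbb E(dg_{n+1}\mid\mathcal F_n)|\le\alpha\,|\mathbb E(df_{n+1}\mid\mathcal F_n)|.$$ Then for every filtration and every admissible pair $(f,g)$, $$\|g^*\|_p\le(\alpha+1)p\,\|f\|_p,\qquad\text{and hence also}\qquad \|g^*\|_p\le(\alpha+1)p\,\|f^*\|_p.$$ If $\mathbb P$ is non-atomic, the constant $(\alpha+1)p$ is the best possible in the first estimate, and already in the weaker second one: for every real $r<(\alpha+1)p$ there are a filtration on $(\Omega,\mathcal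 F,\mathbb P)$ and an admissible pair $(f,g)$ with $\|g^*\|_p>r\,\|f\|_p$, and there are a filtration and an admissible pair with $\|g^*\|_p>r\,\|f^*\|_p$. -/

import Mathlib

open MeasureTheory ProbabilityTheory
open scoped ENNReal

namespace MaximalIneq

/-- The difference sequence of a process: `d f 0 = f 0` and `d f (n + 1) = f (n + 1) - f n`,
so that `f n = ∑ k ∈ range (n + 1), d f k`. -/
def diffSeq {Ω : Type*} (f : ℕ → Ω → ℝ) : ℕ → Ω → ℝ
  | 0 => f 0
  | n + 1 => f (n + 1) - f n

/-- `g` is differentially subordinate to `f`: for every `n`, `|d g n| ≤ |d f n|` almost surely. -/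
def DiffSubordinate {Ω : Type*} [MeasurableSpace Ω] (P : Measure Ω) (g f : ℕ → Ω → ℝ) : Prop :=
  ∀ n, ∀ᵐ ω ∂P, |diffSeq g n ω| ≤ |diffSeq f n ω|

/-- `g` is `α`-strongly subordinate to `f`: it is differentially subordinate to `f` and, for
every `n`, `|E(d g (n+1) | ℱ n)| ≤ α |E(d f (n+1) | ℱ n)|` almost surely. -/
def StronglySubordinate {Ω : Type*} {m : MeasurableSpace Ω} (P : Measure Ω)
    (ℱ : Filtration ℕ m) (α : ℝ) (g f : ℕ → Ω → ℝ) : Prop :=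
  DiffSubordinate P g f ∧
    ∀ n, ∀ᵐ ω ∂P, |(P[diffSeq g (n + 1) | ℱ n]) ω| ≤ α * |(P[diffSeq f (n + 1) | ℱ n]) ω|

/-- The pairs `(f, g)` in question: `f` is a non-negative submartingale, `g` is an adapted
integrable real-valued process, and `g` is `α`-strongly subordinate to `f`. -/
structure AdmissiblePair {Ω : Type*} {m : MeasurableSpace Ω} (P : Measure Ω)
    (ℱ : Filtration ℕ m) (α : ℝ) (f g : ℕ → Ω → ℝ) : Prop where
  submartingale : Submartingale f ℱ P
  nonneg : ∀ n, 0 ≤ᵐ[P] f n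
  adapted : StronglyAdapted ℱ g
  integrable : ∀ n, Integrable (g n) P
  subordinate : StronglySubordinate P ℱ α g f

/-- The maximal function `f* = sup_n |f n|`, with values in `[0, ∞]`. -/
noncomputable def maxFun {Ω : Type*} (f : ℕ → Ω → ℝ) : Ω → ℝ≥0∞ :=
  fun ω => ⨆ n, ENNReal.ofReal |f n ω|

/-- The norm of a process, `‖f‖_p = sup_n ‖f n‖_p`, with values in `[0, ∞]`. -/
noncomputable def processNorm {Ω : Type*} [MeasurableSpace Ω] (P : Measure Ω) (p : ℝ)
    (f : ℕ → Ω → ℝ) : ℝ≥0∞ :=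
  ⨆ n, eLpNorm (f n) (ENNReal.ofReal p) P

/-- The norm of a maximal function, `‖f*‖_p`, with values in `[0, ∞]`. -/
noncomputable def maxNorm {Ω : Type*} [MeasurableSpace Ω] (P : Measure Ω) (p : ℝ)
    (f : ℕ → Ω → ℝ) : ℝ≥0∞ :=
  eLpNorm (maxFun f) (ENNReal.ofReal p) P

/-- A measure is non-atomic if every measurable set of positive measure has a measurable subset
of strictly smaller positive measure. (Mathlib's `NoAtoms` only says that points are null.) -/
def NonAtomic {Ω : Type*} [MeasurableSpace Ω] (P : Measure Ω) : Prop :=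
  ∀ A : Set Ω, MeasurableSet A → 0 < P A →
    ∃ B : Set Ω, B ⊆ A ∧ MeasurableSet B ∧ 0 < P B ∧ P B < P A

end MaximalIneq

/-! The upper bound is Burkholder's method. Put C = (α + 1)p, let z be the running maximum of |g|,
and let U = `specialFun` have the form F(r) - xG(r) with r = x + |y|. Then U majorizes z^p - (Cx)^p
(`le_specialFun`), is nonpositive at the possible starting points (`specialFun_initial_nonpos`), and
does not grow when z is updated to max(z, |y|) (`specialFun_max_le`). It lies below its tangents in
the directions (h, k) with |k| ≤ |h| (`specialFun_tangent`), and U_x + α|U_y| ≤ 0 where |y| ≤ z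
(`derivX_add_mul_abs_derivY_nonpos`). Differential subordination puts each step in such a direction.
The submartingale property and the bound on conditional drifts make the linear term nonpositive in
mean. Hence the mean of U stays nonpositive along the pair, which bounds the p-th moment of the
running maximum, and monotone convergence finishes.

For sharpness, f repeatedly rises from 0 to a small height and then takes a mean-zero jump: either
up to an exit height, where it stops, or back to 0. The transform has multiplier α on rises and -1
on jumps, so a rise to a followed by a drop to 0 adds (α + 1)a to g. If the rise is δ times the
current g, then g grows by l = 1 + (α + 1)δ per round. With survival probability s = l^(-p), each
level adds the same amount to the p-th moments, and the ratio of the contributions of g and f is ((1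
- s)/δ)^p. As δ → 0, (1 - s)/δ tends to (α + 1)p (`exists_small_rise`), and many levels make the
boundary terms negligible. The random level is built from Sierpiński's theorem
(`NonAtomic.exists_measure_eq`). -/

namespace MaximalIneq

/-! ### Convexity inequalities for powers -/

section PowerInequalities

/-- The graph of `x ↦ x ^ q`, `q ≥ 1`, lies above its tangents. -/
theorem rpow_tangent_le {q a b : ℝ} (hq : 1 ≤ q) (ha : 0 ≤ a) (hb : 0 ≤ b) :
    b ^ q + q * b ^ (q - 1) * (a - b) ≤ a ^ q := by
  rcases hb.eq_or_lt with rfl | hb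
  · rcases hq.eq_or_lt with rfl | hq
    · simp
    · rw [Real.zero_rpow (by linarith), Real.zero_rpow (by linarith)]
      simpa using Real.rpow_nonneg ha q
  · have h := one_add_mul_self_le_rpow_one_add (s := a / b - 1) (by
      have := div_nonneg ha hb.le; linarith) hq
    have h1 : (1 + (a / b - 1)) = a / b := by ring
    rw [h1, Real.div_rpow ha hb.le, le_div_iff₀ (Real.rpow_pos_of_pos hb q)] at h
    have h2 : b ^ q = b ^ (q - 1) * b := by
      rw [← Real.rpow_add_one hb.ne']; ring_nf
    calc b ^ q + q * b ^ (q - 1) * (a - b) = (1 + q * (a / b - 1)) * b ^ q := by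
          rw [h2]; field_simp
      _ ≤ a ^ q := h

/-- The trapezoidal rule overestimates the integral of a convex power. -/
theorem rpow_sub_rpow_le_trapezoid {p a b : ℝ} (hp : 2 ≤ p) (ha : 0 ≤ a) (hab : a ≤ b) :
    b ^ p - a ^ p ≤ p / 2 * (b - a) * (a ^ (p - 1) + b ^ (p - 1)) := by
  let φ : ℝ → ℝ := fun t => p / 2 * (t - a) * (a ^ (p - 1) + t ^ (p - 1)) - t ^ p
  have hd : ∀ t, HasDerivAt φ (p / 2 * (a ^ (p - 1) + t ^ (p - 1)) +
      p / 2 * (t - a) * ((p - 1) * t ^ (p - 1 - 1)) - p * t ^ (p - 1)) t := by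
    intro t
    have h1 : HasDerivAt (fun t : ℝ => t ^ (p - 1)) ((p - 1) * t ^ (p - 1 - 1)) t :=
      Real.hasDerivAt_rpow_const (Or.inr (by linarith))
    have h2 : HasDerivAt (fun t : ℝ => t ^ p) (p * t ^ (p - 1)) t :=
      Real.hasDerivAt_rpow_const (Or.inr (by linarith))
    have h3 : HasDerivAt (fun t : ℝ => p / 2 * (t - a)) (p / 2) t := by
      simpa using ((hasDerivAt_id t).sub_const a).const_mul (p / 2)
    exact (h3.mul (h1.const_add _)).sub h2
  have hmono : MonotoneOn φ (Set.Ici a) := by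
    refine monotoneOn_of_deriv_nonneg (convex_Ici a)
      (fun t _ => (hd t).continuousAt.continuousWithinAt)
      (fun t _ => (hd t).differentiableAt.differentiableWithinAt) fun t ht => ?_
    rw [interior_Ici, Set.mem_Ioi] at ht
    rw [(hd t).deriv]
    have := rpow_tangent_le (q := p - 1) (by linarith) ha (ha.trans ht.le)
    nlinarith
  have := hmono (Set.mem_Ici.2 le_rfl) (Set.mem_Ici.2 hab) hab
  simp only [φ, sub_self, mul_zero, zero_mul] at this
  linarith

/-- A quadratic upper bound for `x ^ p` to the left of the point of expansion. -/
theorem rpow_le_taylor_left {p a b : ℝ} (hp : 2 ≤ p) (ha : 0 ≤ a) (hab : a ≤ b) :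
    a ^ p ≤ b ^ p - p * b ^ (p - 1) * (b - a)
      + p * (p - 1) / 2 * b ^ (p - 2) * (b - a) ^ 2 := by
  let φ : ℝ → ℝ := fun t => p * b ^ (p - 1) * (b - t)
    - p * (p - 1) / 2 * b ^ (p - 2) * (b - t) ^ 2 + t ^ p
  have hd : ∀ t, HasDerivAt φ (p * b ^ (p - 1) * (-1)
      - p * (p - 1) / 2 * b ^ (p - 2) * (2 * (b - t) * (-1)) + p * t ^ (p - 1)) t := by
    intro t
    have h2 : HasDerivAt (fun t : ℝ => t ^ p) (p * t ^ (p - 1)) t :=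
      Real.hasDerivAt_rpow_const (Or.inr (by linarith))
    have h3 : HasDerivAt (fun t : ℝ => b - t) (-1) t := by
      simpa using (hasDerivAt_id t).const_sub b
    have h4 : HasDerivAt (fun t : ℝ => (b - t) ^ 2) (2 * (b - t) * (-1)) t := by
      simpa using h3.fun_pow 2
    exact ((h3.const_mul _).sub (h4.const_mul _)).add h2
  have hmono : MonotoneOn φ (Set.Icc 0 b) := by
    refine monotoneOn_of_deriv_nonneg (convex_Icc 0 b)
      (fun t _ => (hd t).continuousAt.continuousWithinAt)
      (fun t _ => (hd t).differentiableAt.differentiableWithinAt) fun t ht => ?_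
    rw [interior_Icc, Set.mem_Ioo] at ht
    rw [(hd t).deriv]
    have := rpow_tangent_le (q := p - 1) (by linarith) ht.1.le (ha.trans hab)
    rw [show p - 1 - 1 = p - 2 by ring] at this
    nlinarith
  have := hmono ⟨ha, hab⟩ ⟨ha.trans hab, le_rfl⟩ hab
  simp only [φ, sub_self, mul_zero] at this
  norm_num at this
  linarith

/-- A mean value estimate for `x ^ p` with an asymmetric intermediate point. -/
theorem rpow_sub_rpow_le_weighted {p t z : ℝ} (hp : 2 ≤ p) (ht : 0 ≤ t) (hz : 0 ≤ z) :
    z ^ p - t ^ p ≤ p * ((t + (p - 1) * z) / p) ^ (p - 1) * (z - t) := by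
  let s : ℝ → ℝ := fun t => (t + (p - 1) * z) / p
  let φ : ℝ → ℝ := fun t => p * s t ^ (p - 1) * (z - t) + t ^ p
  have hp0 : p ≠ 0 := by linarith
  have hd : ∀ t, HasDerivAt φ (p * (1 / p * (p - 1) * s t ^ (p - 1 - 1)) * (z - t) +
      p * s t ^ (p - 1) * (-1) + p * t ^ (p - 1)) t := by
    intro t
    have h2 : HasDerivAt (fun t : ℝ => t ^ p) (p * t ^ (p - 1)) t :=
      Real.hasDerivAt_rpow_const (Or.inr (by linarith))
    have h3 : HasDerivAt (fun t : ℝ => z - t) (-1) t := by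
      simpa using (hasDerivAt_id t).const_sub z
    have h4 : HasDerivAt s (1 / p) t := ((hasDerivAt_id t).add_const _).div_const p
    have h5 : HasDerivAt (fun t => s t ^ (p - 1)) (1 / p * (p - 1) * s t ^ (p - 1 - 1)) t :=
      h4.rpow_const (Or.inr (by linarith))
    exact ((h5.const_mul p).mul h3).add h2
  have hs : ∀ t, s t - t = (p - 1) * (z - t) / p := by
    intro t; simp only [s]; field_simp; ring
  have hs0 : ∀ t, 0 ≤ t → 0 ≤ s t := fun t ht =>
    div_nonneg (add_nonneg ht (mul_nonneg (by linarith) hz)) (by linarith)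
  have hd' : ∀ t, 0 < t → deriv φ t = p * t * (t ^ (p - 2) - s t ^ (p - 2)) := by
    intro t ht
    have hst : 0 < s t := div_pos (add_pos_of_pos_of_nonneg ht (mul_nonneg (by linarith) hz))
      (by linarith)
    have e1 : t ^ (p - 1) = t ^ (p - 2) * t := by
      rw [← Real.rpow_add_one ht.ne']; ring_nf
    have e2 : s t ^ (p - 1) = s t ^ (p - 2) * s t := by
      rw [← Real.rpow_add_one hst.ne']; ring_nf
    -- This identity is the reason for the weights 1 and p - 1: it reduces the derivative of φ to p
    -- t (t^(p-2) - s^(p-2)), whose sign change at t = z gives the minimum.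
    have e3 : (p - 1) * (z - t) = p * (s t - t) := by rw [hs]; field_simp
    rw [(hd t).deriv, e1, e2, show p - 1 - 1 = p - 2 by ring]
    have : p * (1 / p * (p - 1) * s t ^ (p - 2)) * (z - t)
        = ((p - 1) * (z - t)) * s t ^ (p - 2) := by field_simp
    rw [this, e3]; ring
  have key : φ z ≤ φ t := by
    rcases le_total t z with h | h
    · have hanti : AntitoneOn φ (Set.Icc 0 z) := by
        refine antitoneOn_of_deriv_nonpos (convex_Icc 0 z)
          (fun t _ => (hd t).continuousAt.continuousWithinAt)
          (fun t _ => (hd t).differentiableAt.differentiableWithinAt) fun u hu => ?_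
        rw [interior_Icc, Set.mem_Ioo] at hu
        rw [hd' u hu.1]
        have h1 : u ≤ s u := by
          have := hs u
          have h2 : 0 ≤ (p - 1) * (z - u) / p :=
            div_nonneg (mul_nonneg (by linarith) (by linarith [hu.2])) (by linarith)
          linarith
        have := Real.rpow_le_rpow hu.1.le h1 (z := p - 2) (by linarith)
        exact mul_nonpos_of_nonneg_of_nonpos (mul_nonneg (by linarith) hu.1.le) (by linarith)
      exact hanti ⟨ht, h⟩ ⟨hz, le_rfl⟩ h
    · have hmono : MonotoneOn φ (Set.Ici z) := by
        refine monotoneOn_of_deriv_nonneg (convex_Ici z)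
          (fun t _ => (hd t).continuousAt.continuousWithinAt)
          (fun t _ => (hd t).differentiableAt.differentiableWithinAt) fun u hu => ?_
        rw [interior_Ici, Set.mem_Ioi] at hu
        have hu0 : 0 < u := hz.trans_lt hu
        rw [hd' u hu0]
        have h1 : s u ≤ u := by
          have := hs u
          have h2 : (p - 1) * (z - u) / p ≤ 0 :=
            div_nonpos_of_nonpos_of_nonneg
              (mul_nonpos_of_nonneg_of_nonpos (by linarith) (by linarith)) (by linarith)
          linarith
        have := Real.rpow_le_rpow (hs0 u hu0.le) h1 (z := p - 2) (by linarith)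
        exact mul_nonneg (mul_nonneg (by linarith) hu0.le) (by linarith)
      exact hmono (Set.mem_Ici.2 le_rfl) (Set.mem_Ici.2 h) h
  simp only [φ, sub_self, mul_zero, s] at key
  linarith

/-- The elementary inequality behind the majorization of `z ^ p - (C * x) ^ p`. -/
theorem three_variable_rpow_nonneg {p s t z : ℝ} (hp : 2 ≤ p) (hs : 0 ≤ s) (ht : 0 ≤ t)
    (hz : 0 ≤ z) :
    0 ≤ (p - 1) ^ 2 * z ^ p + p ^ 2 * s ^ p - p ^ 2 * z ^ (p - 1) * s - p ^ 2 * t * s ^ (p - 1)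
      + p * t * z ^ (p - 1) + (p - 1) * t ^ p := by
  have main : ∀ t, 0 ≤ t → t ≤ p * s →
      0 ≤ (p - 1) ^ 2 * z ^ p + p ^ 2 * s ^ p - p ^ 2 * z ^ (p - 1) * s
        - p ^ 2 * t * s ^ (p - 1) + p * t * z ^ (p - 1) + (p - 1) * t ^ p := by
    intro t ht hts
    -- With w chosen so that s is the weighted mean of t and w, the expression is p - 1 times the
    -- sum of two deficits: that of the weighted mean value estimate for (t, w), and that of the
    -- tangent at z evaluated at w. The powers of w cancel.
    set w := (p * s - t) / (p - 1) with hw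
    have hp1 : p - 1 ≠ 0 := by linarith
    have hw0 : 0 ≤ w := div_nonneg (by linarith) (by linarith)
    have hws : (p - 1) * w = p * s - t := by rw [hw]; field_simp
    have hK := rpow_sub_rpow_le_weighted hp ht hw0
    have e : (t + (p - 1) * w) / p = s := by
      rw [hws]; field_simp; ring
    rw [e] at hK
    have hT := rpow_tangent_le (q := p) (by linarith) hw0 hz
    have e1 : s ^ p = s ^ (p - 1) * s := by
      rcases hs.eq_or_lt with rfl | hs
      · rw [Real.zero_rpow (by linarith)]; simp
      · rw [← Real.rpow_add_one hs.ne']; ring_nf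
    have e2 : z ^ p = z ^ (p - 1) * z := by
      rcases hz.eq_or_lt with rfl | hz
      · rw [Real.zero_rpow (by linarith)]; simp
      · rw [← Real.rpow_add_one hz.ne']; ring_nf
    have hp1' : 0 ≤ p - 1 := by linarith
    have a1 := mul_le_mul_of_nonneg_left hK hp1'
    have a2 := mul_le_mul_of_nonneg_left hT hp1'
    have a3 : (p - 1) * (p * s ^ (p - 1) * (w - t)) = p * s ^ (p - 1) * (p * s - t - (p - 1) * t) := by
      rw [← hws]; ring
    have a4 : (p - 1) * (z ^ p + p * z ^ (p - 1) * (w - z))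
        = (p - 1) * z ^ p + p * z ^ (p - 1) * (p * s - t - (p - 1) * z) := by
      rw [← hws]; ring
    rw [a3] at a1
    rw [a4] at a2
    rw [e1]
    rw [e2] at a2 ⊢
    nlinarith
  rcases le_total t (p * s) with h | h
  · exact main t ht h
  -- Here w would be negative. The expression is convex in t and its slope at t = p s is
  -- nonnegative, so it is bounded below by its value there.
  · have hps : 0 ≤ p * s := mul_nonneg (by linarith) hs
    have h0 := main (p * s) hps le_rfl
    have hT := rpow_tangent_le (q := p) (by linarith) ht hps
    have hmono : s ^ (p - 1) * p ≤ (p * s) ^ (p - 1) := by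
      rw [Real.mul_rpow (by linarith) hs, mul_comm]
      refine mul_le_mul_of_nonneg_right ?_ (Real.rpow_nonneg hs _)
      calc p = p ^ (1 : ℝ) := (Real.rpow_one p).symm
        _ ≤ p ^ (p - 1) := Real.rpow_le_rpow_of_exponent_le (by linarith) (by linarith)
    have hz1 : 0 ≤ z ^ (p - 1) := Real.rpow_nonneg hz _
    have hs1 : 0 ≤ s ^ (p - 1) := Real.rpow_nonneg hs _
    have a1 : (p - 1) * ((p * s) ^ p + p * (p * s) ^ (p - 1) * (t - p * s)) ≤ (p - 1) * t ^ p :=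
      mul_le_mul_of_nonneg_left hT (by linarith)
    have a2 : p * (t - p * s) * (s ^ (p - 1) * p) ≤
        p * (t - p * s) * ((p - 1) * (p * s) ^ (p - 1)) := by
      refine mul_le_mul_of_nonneg_left ?_ (mul_nonneg (by linarith) (by linarith))
      have : 0 ≤ (p * s) ^ (p - 1) := Real.rpow_nonneg hps _
      nlinarith
    have a3 : 0 ≤ p * (t - p * s) * z ^ (p - 1) :=
      mul_nonneg (mul_nonneg (by linarith) (by linarith)) hz1
    nlinarith

end PowerInequalities

/-! ### The special function and its concavity along half planes -/

section SpecialFunction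

/-- The coefficient of the leading power of the special function. -/
noncomputable def leadCoeff (p C : ℝ) : ℝ := p + C / (p - 1)

/-- The level of `|x| + |y|` below which the special function is flat. -/
noncomputable def cutoff (p C z : ℝ) : ℝ := (C / ((p - 1) * leadCoeff p C)) ^ (1 / (p - 1)) * z

/-- The special function on the axis `x = 0`, as a function of `r = x + |y|`. -/
noncomputable def axisVal (p C z r : ℝ) : ℝ :=
  leadCoeff p C * (max r (cutoff p C z) ^ p
    - p * cutoff p C z ^ (p - 1) * max r (cutoff p C z)) + C * z ^ p

/-- The derivative of `axisVal` in `r`. -/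
noncomputable def axisDeriv (p C z r : ℝ) : ℝ :=
  p * leadCoeff p C * (max r (cutoff p C z) ^ (p - 1) - cutoff p C z ^ (p - 1))

/-- Minus the slope of the special function on the lines `x + |y| = r`. -/
noncomputable def slopeVal (p C z r : ℝ) : ℝ :=
  p * C / (p - 1) * max 0 (p * r ^ (p - 1) - z ^ (p - 1))

/-- The derivative of `slopeVal` in `r`. -/
noncomputable def slopeDeriv (p C z r : ℝ) : ℝ :=
  if z ^ (p - 1) < p * r ^ (p - 1) then p ^ 2 * C * r ^ (p - 2) else 0

/-- The special function. -/
noncomputable def specialFun (p C x y z : ℝ) : ℝ :=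
  axisVal p C z (x + |y|) - x * slopeVal p C z (x + |y|)

/-- The derivative of the special function in `|y|`. -/
noncomputable def radialDeriv (p C x y z : ℝ) : ℝ :=
  axisDeriv p C z (x + |y|) - x * slopeDeriv p C z (x + |y|)

/-- The derivative of the special function in `x`. -/
noncomputable def derivX (p C x y z : ℝ) : ℝ :=
  radialDeriv p C x y z - slopeVal p C z (x + |y|)

/-- The derivative of the special function in `y`. -/
noncomputable def derivY (p C x y z : ℝ) : ℝ :=
  if 0 ≤ y then radialDeriv p C x y z else -radialDeriv p C x y z

variable {p C : ℝ}

theorem leadCoeff_pos (hp : 2 ≤ p) (hC : p ≤ C) : 0 < leadCoeff p C :=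
  add_pos (by linarith) (div_pos (by linarith) (by linarith))

theorem pred_mul_leadCoeff (hp : 2 ≤ p) : (p - 1) * leadCoeff p C = p * (p - 1) + C := by
  have : p - 1 ≠ 0 := by linarith
  unfold leadCoeff; field_simp

theorem rpow_eq_rpow_pred_mul {p s : ℝ} (hp : 2 ≤ p) (hs : 0 ≤ s) : s ^ p = s ^ (p - 1) * s := by
  rcases hs.eq_or_lt with rfl | hs
  · rw [Real.zero_rpow (by linarith)]; simp
  · rw [← Real.rpow_add_one hs.ne']; ring_nf

theorem rpow_pred_eq {p s : ℝ} (hs : 0 < s) : s ^ (p - 1) = s ^ (p - 2) * s := by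
  rw [← Real.rpow_add_one hs.ne']; ring_nf

theorem cutoff_nonneg (hp : 2 ≤ p) (hC : p ≤ C) {z : ℝ} (hz : 0 ≤ z) : 0 ≤ cutoff p C z := by
  have := leadCoeff_pos hp hC
  exact mul_nonneg (Real.rpow_nonneg (div_nonneg (by linarith)
    (mul_nonneg (by linarith) this.le)) _) hz

/-- The cutoff is the zero of the derivative of the power formula for F, so freezing F below it
leaves F continuously differentiable. -/
theorem leadCoeff_mul_cutoff_rpow (hp : 2 ≤ p) (hC : p ≤ C) {z : ℝ} (hz : 0 ≤ z) :
    leadCoeff p C * cutoff p C z ^ (p - 1) = C / (p - 1) * z ^ (p - 1) := by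
  have hD := leadCoeff_pos hp hC
  have h1 : p - 1 ≠ 0 := by linarith
  have h0 : 0 ≤ C / ((p - 1) * leadCoeff p C) :=
    div_nonneg (by linarith) (mul_nonneg (by linarith) hD.le)
  unfold cutoff
  rw [Real.mul_rpow (Real.rpow_nonneg h0 _) hz, ← Real.rpow_mul h0, one_div,
    inv_mul_cancel₀ h1, Real.rpow_one]
  field_simp

theorem cutoff_le (hp : 2 ≤ p) (hC : p ≤ C) {z : ℝ} (hz : 0 ≤ z) : cutoff p C z ≤ z := by
  have hD := leadCoeff_pos hp hC
  have hp1 : 0 < p - 1 := by linarith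
  refine mul_le_of_le_one_left hz (Real.rpow_le_one (div_nonneg (by linarith)
    (mul_nonneg (by linarith) hD.le)) ?_ (div_nonneg zero_le_one hp1.le))
  rw [div_le_one (mul_pos hp1 hD), pred_mul_leadCoeff hp]
  nlinarith

/-- Above the cutoff the positive part in `slopeVal` can therefore be dropped. The inequality rests
on p(p - 1) + C ≤ pC, which is a form of p ≤ C. -/
theorem le_mul_cutoff_rpow (hp : 2 ≤ p) (hC : p ≤ C) {z : ℝ} (hz : 0 ≤ z) :
    z ^ (p - 1) ≤ p * cutoff p C z ^ (p - 1) := by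
  have hD := leadCoeff_pos hp hC
  have h := leadCoeff_mul_cutoff_rpow hp hC hz
  have h2 := pred_mul_leadCoeff (C := C) hp
  have hp1 : 0 < p - 1 := by linarith
  have h3 : (p - 1) * leadCoeff p C * cutoff p C z ^ (p - 1) = C * z ^ (p - 1) := by
    rw [mul_assoc, h]; field_simp
  rw [h2] at h3
  have hZ := Real.rpow_nonneg hz (p - 1)
  have hs := Real.rpow_nonneg (cutoff_nonneg hp hC hz) (p - 1)
  have h4 : C * z ^ (p - 1) ≤ C * (p * cutoff p C z ^ (p - 1)) := by
    rw [← h3]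
    have : p * (p - 1) + C ≤ C * p := by nlinarith
    nlinarith
  exact le_of_mul_le_mul_left h4 (by linarith)

theorem axisVal_of_le {z r : ℝ} (hp : 2 ≤ p) (hC : p ≤ C) (hz : 0 ≤ z) (hr : cutoff p C z ≤ r) :
    axisVal p C z r = leadCoeff p C * r ^ p - p * C / (p - 1) * z ^ (p - 1) * r + C * z ^ p := by
  have h := leadCoeff_mul_cutoff_rpow hp hC hz
  unfold axisVal
  rw [max_eq_left hr]
  linear_combination (-p * r) * h

theorem axisDeriv_of_le {z r : ℝ} (hp : 2 ≤ p) (hC : p ≤ C) (hz : 0 ≤ z)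
    (hr : cutoff p C z ≤ r) :
    axisDeriv p C z r = p * leadCoeff p C * r ^ (p - 1) - p * C / (p - 1) * z ^ (p - 1) := by
  have h := leadCoeff_mul_cutoff_rpow hp hC hz
  unfold axisDeriv
  rw [max_eq_left hr]
  linear_combination (-p) * h

theorem axisDeriv_nonneg {z r : ℝ} (hp : 2 ≤ p) (hC : p ≤ C) (hz : 0 ≤ z) :
    0 ≤ axisDeriv p C z r := by
  have := Real.rpow_le_rpow (cutoff_nonneg hp hC hz) (le_max_right r (cutoff p C z))
    (z := p - 1) (by linarith)
  exact mul_nonneg (mul_nonneg (by linarith) (leadCoeff_pos hp hC).le) (by linarith)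

theorem slopeVal_nonneg {z r : ℝ} (hp : 2 ≤ p) (hC : p ≤ C) : 0 ≤ slopeVal p C z r :=
  mul_nonneg (div_nonneg (mul_nonneg (by linarith) (by linarith)) (by linarith)) (le_max_left _ _)

theorem slopeDeriv_nonneg {z r : ℝ} (hp : 2 ≤ p) (hC : p ≤ C) (hr : 0 ≤ r) :
    0 ≤ slopeDeriv p C z r := by
  unfold slopeDeriv
  split_ifs
  · exact mul_nonneg (mul_nonneg (sq_nonneg p) (by linarith)) (Real.rpow_nonneg hr _)
  · exact le_rfl

theorem slopeVal_mono {z r r' : ℝ} (hp : 2 ≤ p) (hC : p ≤ C) (hr : 0 ≤ r) (hrr : r ≤ r') :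
    slopeVal p C z r ≤ slopeVal p C z r' := by
  have := Real.rpow_le_rpow hr hrr (z := p - 1) (by linarith)
  refine mul_le_mul_of_nonneg_left (max_le_max le_rfl ?_)
    (div_nonneg (mul_nonneg (by linarith) (by linarith)) (by linarith))
  nlinarith

theorem lt_of_cutoff_lt {z r : ℝ} (hp : 2 ≤ p) (hC : p ≤ C) (hz : 0 ≤ z) (hr : cutoff p C z < r) :
    z ^ (p - 1) < p * r ^ (p - 1) := by
  have h1 := le_mul_cutoff_rpow hp hC hz
  have h2 := Real.rpow_lt_rpow (cutoff_nonneg hp hC hz) hr (z := p - 1) (by linarith)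
  nlinarith

theorem slopeVal_of_le {z r : ℝ} (hp : 2 ≤ p) (hC : p ≤ C) (hz : 0 ≤ z) (hr : cutoff p C z ≤ r) :
    slopeVal p C z r = p * C / (p - 1) * (p * r ^ (p - 1) - z ^ (p - 1)) := by
  have h1 := le_mul_cutoff_rpow hp hC hz
  have h2 := Real.rpow_le_rpow (cutoff_nonneg hp hC hz) hr (z := p - 1) (by linarith)
  unfold slopeVal
  rw [max_eq_right]
  nlinarith

/-- `slopeVal` is convex. -/
theorem slopeVal_tangent {z r r' : ℝ} (hp : 2 ≤ p) (hC : p ≤ C) (hr : 0 ≤ r) (hr' : 0 ≤ r') :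
    slopeVal p C z r + slopeDeriv p C z r * (r' - r) ≤ slopeVal p C z r' := by
  have hc : 0 ≤ p * C / (p - 1) := div_nonneg (mul_nonneg (by linarith) (by linarith)) (by linarith)
  by_cases h : z ^ (p - 1) < p * r ^ (p - 1)
  · have hT := rpow_tangent_le (q := p - 1) (by linarith) hr' hr
    rw [show p - 1 - 1 = p - 2 by ring] at hT
    unfold slopeVal slopeDeriv
    rw [if_pos h, max_eq_right (by linarith)]
    have h1 : p * r ^ (p - 1) - z ^ (p - 1) + p * ((p - 1) * r ^ (p - 2) * (r' - r)) ≤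
        max 0 (p * r' ^ (p - 1) - z ^ (p - 1)) := by
      refine le_trans ?_ (le_max_right _ _)
      nlinarith
    have h2 := mul_le_mul_of_nonneg_left h1 hc
    have h3 : p * C / (p - 1) * (p * ((p - 1) * r ^ (p - 2) * (r' - r))) =
        p ^ 2 * C * r ^ (p - 2) * (r' - r) := by
      have : p - 1 ≠ 0 := by linarith
      field_simp
    rw [mul_add, h3] at h2
    exact h2
  · unfold slopeVal slopeDeriv
    rw [if_neg h, max_eq_left (by linarith)]
    simpa using mul_nonneg hc (le_max_left _ _)

/-- `slopeVal - axisDeriv` is increasing. -/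
theorem axisDeriv_sub_le {z r r' : ℝ} (hp : 2 ≤ p) (hC : p ≤ C) (hz : 0 ≤ z) (hr : 0 ≤ r)
    (hrr : r ≤ r') :
    axisDeriv p C z r' - axisDeriv p C z r ≤ slopeVal p C z r' - slopeVal p C z r := by
  have hD := pred_mul_leadCoeff (C := C) hp
  have hp1 : 0 < p - 1 := by linarith
  rcases le_total r' (cutoff p C z) with h | h
  · have e : axisDeriv p C z r' - axisDeriv p C z r = 0 := by
      unfold axisDeriv
      rw [max_eq_right h, max_eq_right (hrr.trans h)]; ring
    linarith [slopeVal_mono hp hC (z := z) hr hrr]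
  · have key : ∀ t, 0 ≤ t → cutoff p C z ≤ t → t ≤ r' →
        axisDeriv p C z r' - axisDeriv p C z t ≤ slopeVal p C z r' - slopeVal p C z t := by
      intro t ht hc htr
      rw [axisDeriv_of_le hp hC hz h, axisDeriv_of_le hp hC hz hc, slopeVal_of_le hp hC hz h,
        slopeVal_of_le hp hC hz hc]
      have h1 := Real.rpow_le_rpow ht htr (z := p - 1) (by linarith)
      -- The terms in z cancel in the differences, so only the coefficients of r^(p-1) have to be
      -- compared.
      have h2 : leadCoeff p C ≤ p * C / (p - 1) := by
        rw [le_div_iff₀ hp1, mul_comm, hD]; nlinarith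
      have h3 : 0 ≤ p * (p * C / (p - 1) - leadCoeff p C) * (r' ^ (p - 1) - t ^ (p - 1)) :=
        mul_nonneg (mul_nonneg (by linarith) (by linarith)) (by linarith)
      nlinarith
    rcases le_total r (cutoff p C z) with h' | h'
    · have h1 := key (cutoff p C z) (cutoff_nonneg hp hC hz) le_rfl h
      have h2 : axisDeriv p C z r = axisDeriv p C z (cutoff p C z) := by
        unfold axisDeriv; rw [max_eq_right h', max_self]
      linarith [slopeVal_mono hp hC (z := z) hr h']
    · exact key r hr h' hrr

/-- Clipping at the cutoff can only shorten the interval, which is harmless since F' is nonnegative.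
-/
theorem axisVal_trapezoid {z r r' : ℝ} (hp : 2 ≤ p) (hC : p ≤ C) (hz : 0 ≤ z)
    (hrr : r ≤ r') :
    axisVal p C z r' - axisVal p C z r ≤
      (r' - r) / 2 * (axisDeriv p C z r + axisDeriv p C z r') := by
  have hD := leadCoeff_pos hp hC
  have hc := cutoff_nonneg hp hC hz
  set c := cutoff p C z with hcdef
  have h1 : c ≤ max r c := le_max_right _ _
  have h2 : max r c ≤ max r' c := max_le_max hrr le_rfl
  have h3 : max r' c - max r c ≤ r' - r := by
    rcases le_total r c with h | h <;> rcases le_total r' c with h' | h' <;>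
      simp only [max_eq_left, max_eq_right, h, h'] <;> linarith
  have hT := rpow_sub_rpow_le_trapezoid hp (hc.trans h1) h2
  have hA := axisDeriv_nonneg (r := r) hp hC hz
  have hA' := axisDeriv_nonneg (r := r') hp hC hz
  have step : axisVal p C z r' - axisVal p C z r ≤
      (max r' c - max r c) / 2 * (axisDeriv p C z r + axisDeriv p C z r') := by
    unfold axisVal axisDeriv
    rw [← hcdef]
    have := mul_le_mul_of_nonneg_left hT hD.le
    nlinarith
  refine step.trans ?_
  have : 0 ≤ axisDeriv p C z r + axisDeriv p C z r' := by linarith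
  nlinarith

theorem axisVal_le_taylor_left {z r r' : ℝ} (hp : 2 ≤ p) (hC : p ≤ C) (hz : 0 ≤ z) (hr' : 0 ≤ r')
    (hrr : r' ≤ r) :
    axisVal p C z r' ≤ axisVal p C z r - axisDeriv p C z r * (r - r')
      + slopeDeriv p C z r / 2 * (r - r') ^ 2 := by
  have hD := leadCoeff_pos hp hC
  have hc := cutoff_nonneg hp hC hz
  have hr : 0 ≤ r := hr'.trans hrr
  rcases le_or_gt r (cutoff p C z) with h | h
  · have h0 := slopeDeriv_nonneg (z := z) hp hC hr
    unfold axisVal axisDeriv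
    rw [max_eq_right h, max_eq_right (hrr.trans h)]
    have : 0 ≤ slopeDeriv p C z r / 2 * (r - r') ^ 2 :=
      mul_nonneg (by linarith) (sq_nonneg _)
    linarith
  · have hs : slopeDeriv p C z r = p ^ 2 * C * r ^ (p - 2) := if_pos (lt_of_cutoff_lt hp hC hz h)
    have hrp : 0 ≤ r ^ (p - 2) := Real.rpow_nonneg hr _
    have hDC : leadCoeff p C * (p - 1) ≤ p * C := by
      rw [mul_comm, pred_mul_leadCoeff hp]; nlinarith
    have key : ∀ t, 0 ≤ t → cutoff p C z ≤ t → t ≤ r →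
        axisVal p C z t ≤ axisVal p C z r - axisDeriv p C z r * (r - t)
          + slopeDeriv p C z r / 2 * (r - t) ^ 2 := by
      intro t ht hct htr
      rw [axisVal_of_le hp hC hz hct, axisVal_of_le hp hC hz h.le, axisDeriv_of_le hp hC hz h.le, hs]
      have h1 := mul_le_mul_of_nonneg_left (rpow_le_taylor_left hp ht htr) hD.le
      have h2 : 0 ≤ (p * C - leadCoeff p C * (p - 1)) * (p / 2 * r ^ (p - 2) * (r - t) ^ 2) :=
        mul_nonneg (by linarith) (mul_nonneg (mul_nonneg (by linarith) hrp) (sq_nonneg _))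
      nlinarith
    rcases le_total r' (cutoff p C z) with h' | h'
    · have h1 := key _ hc le_rfl h.le
      have h2 : axisVal p C z r' = axisVal p C z (cutoff p C z) := by
        unfold axisVal; rw [max_eq_right h', max_self]
      set c := cutoff p C z with hcdef
      rw [h2]
      -- F is frozen to the left of c, so it suffices that the comparison parabola does not drop
      -- when moving left from c. This bound says that its vertex lies at or to the right of c.
      have h3 : axisDeriv p C z r ≤ slopeDeriv p C z r * (r - c) := by
        unfold axisDeriv
        rw [← hcdef, max_eq_left h.le, hs]
        have hT := rpow_tangent_le (q := p - 1) (by linarith) hc hr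
        rw [show p - 1 - 1 = p - 2 by ring] at hT
        have h4 : r ^ (p - 1) - c ^ (p - 1) ≤ (p - 1) * r ^ (p - 2) * (r - c) := by linarith
        have h5 := mul_le_mul_of_nonneg_left h4 (mul_nonneg (by linarith : 0 ≤ p) hD.le)
        have h6 : 0 ≤ (p * C - leadCoeff p C * (p - 1)) * (p * r ^ (p - 2) * (r - c)) :=
          mul_nonneg (by linarith) (mul_nonneg (mul_nonneg (by linarith) hrp) (by linarith))
        nlinarith
      have h7 : 0 ≤ slopeDeriv p C z r := slopeDeriv_nonneg hp hC hr
      have h8 := mul_le_mul_of_nonneg_right h3 (by linarith : 0 ≤ c - r')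
      have h9 : 0 ≤ slopeDeriv p C z r * ((c - r') * (c - r')) :=
        mul_nonneg h7 (mul_self_nonneg _)
      nlinarith
    · exact key r' hr' h' hrr

/-- The tangent inequality on a half plane `0 ≤ y`, where the special function is smooth. -/
theorem axisVal_sub_slopeVal_tangent {x h r d z : ℝ} (hp : 2 ≤ p) (hC : p ≤ C) (hz : 0 ≤ z)
    (hx : 0 ≤ x) (hxh : 0 ≤ x + h) (hr : 0 ≤ r) (hrd : 0 ≤ r + d)
    (hd : |d - h| ≤ |h|) :
    axisVal p C z (r + d) - (x + h) * slopeVal p C z (r + d) ≤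
      axisVal p C z r - x * slopeVal p C z r
        + (axisDeriv p C z r - x * slopeDeriv p C z r) * d - h * slopeVal p C z r := by
  have hG := slopeVal_tangent (z := z) hp hC hr hrd
  rw [add_sub_cancel_left] at hG
  rcases le_total 0 h with hh | hh
  -- Here 0 ≤ d ≤ 2h. The trapezoidal rule overshoots the linear term of F by at most d/2 times the
  -- increase of G, and h ≥ d/2 pays for that.
  · rw [abs_of_nonneg hh, abs_le] at hd
    have hd0 : 0 ≤ d := by linarith
    have h1 := axisVal_trapezoid hp hC hz (le_add_of_nonneg_right hd0 : r ≤ r + d)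
    have h2 := axisDeriv_sub_le hp hC hz hr (le_add_of_nonneg_right hd0 : r ≤ r + d)
    have h3 := slopeVal_mono (z := z) hp hC hr (le_add_of_nonneg_right hd0 : r ≤ r + d)
    rw [add_sub_cancel_left] at h1
    have h4 := mul_le_mul_of_nonneg_left h2 hd0
    have h5 : 0 ≤ (2 * h - d) * (slopeVal p C z (r + d) - slopeVal p C z r) :=
      mul_nonneg (by linarith) (by linarith)
    have h6 := mul_le_mul_of_nonneg_left hG hx
    nlinarith
  -- Here 2h ≤ d ≤ 0. Convexity of G, weighted by x + h, leaves a term -h d G'(r), and it dominates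
  -- the Taylor remainder G'(r) d²/2.
  · rw [abs_of_nonpos hh, abs_le] at hd
    have hd0 : d ≤ 0 := by linarith
    have h1 := axisVal_le_taylor_left hp hC hz hrd (by linarith : r + d ≤ r)
    have h2 := slopeDeriv_nonneg (z := z) hp hC hr
    have h3 : 0 ≤ (x + h) * (slopeVal p C z (r + d) - slopeVal p C z r - slopeDeriv p C z r * d) :=
      mul_nonneg hxh (by linarith)
    have h4 : 0 ≤ slopeDeriv p C z r * ((-d) * (d - 2 * h)) :=
      mul_nonneg h2 (mul_nonneg (by linarith) (by linarith))
    nlinarith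

end SpecialFunction

/-! ### Tangent inequality across the kink, drift condition, majorization -/

section SpecialFunction

variable {p C : ℝ}

theorem specialFun_neg (x y z : ℝ) : specialFun p C x (-y) z = specialFun p C x y z := by
  simp [specialFun]

theorem axisDeriv_le_mul_slopeDeriv {z r : ℝ} (hp : 2 ≤ p) (hC : p ≤ C) (hz : 0 ≤ z)
    (hr : 0 ≤ r) : axisDeriv p C z r ≤ r * slopeDeriv p C z r := by
  have hD := leadCoeff_pos hp hC
  have hc := cutoff_nonneg hp hC hz
  rcases le_or_gt r (cutoff p C z) with h | h
  · have h0 := slopeDeriv_nonneg (z := z) hp hC hr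
    unfold axisDeriv
    rw [max_eq_right h, sub_self, mul_zero]
    exact mul_nonneg hr h0
  · have hs : slopeDeriv p C z r = p ^ 2 * C * r ^ (p - 2) := if_pos (lt_of_cutoff_lt hp hC hz h)
    rw [hs]
    have hr0 : 0 < r := hc.trans_lt h
    have hZ : 0 ≤ cutoff p C z ^ (p - 1) := Real.rpow_nonneg hc _
    have e := rpow_pred_eq (p := p) hr0
    have hrp : 0 ≤ r ^ (p - 1) := Real.rpow_nonneg hr _
    have hDC : leadCoeff p C ≤ p * C := by
      have := pred_mul_leadCoeff (C := C) hp
      nlinarith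
    unfold axisDeriv
    rw [max_eq_left h.le]
    have h1 : 0 ≤ p * (p * C - leadCoeff p C) * r ^ (p - 1) :=
      mul_nonneg (mul_nonneg (by linarith) (by linarith)) hrp
    have h2 : 0 ≤ p * leadCoeff p C * cutoff p C z ^ (p - 1) :=
      mul_nonneg (mul_nonneg (by linarith) hD.le) hZ
    rw [e] at h1 ⊢
    nlinarith

/-- As U is even in y, a nonpositive one-sided slope makes the kink at y = 0 a concave one. -/
theorem radialDeriv_zero_nonpos {x z : ℝ} (hp : 2 ≤ p) (hC : p ≤ C) (hz : 0 ≤ z)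
    (hx : 0 ≤ x) : radialDeriv p C x 0 z ≤ 0 := by
  have := axisDeriv_le_mul_slopeDeriv hp hC hz hx
  simp only [radialDeriv, abs_zero, add_zero]
  linarith

theorem specialFun_tangent_of_nonneg {x y h k z : ℝ} (hp : 2 ≤ p) (hC : p ≤ C) (hz : 0 ≤ z)
    (hx : 0 ≤ x) (hxh : 0 ≤ x + h) (hy : 0 ≤ y) (hyk : 0 ≤ y + k) (hk : |k| ≤ |h|) :
    specialFun p C (x + h) (y + k) z ≤
      specialFun p C x y z + derivX p C x y z * h + radialDeriv p C x y z * k := by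
  have := axisVal_sub_slopeVal_tangent (x := x) (h := h) (r := x + y) (d := h + k) hp hC hz hx hxh
    (by linarith) (by linarith) (by simpa using hk)
  unfold specialFun derivX radialDeriv
  rw [abs_of_nonneg hy, abs_of_nonneg hyk, show x + h + (y + k) = x + y + (h + k) by ring]
  linarith

/-- The segment is cut where it meets y = 0. Each part satisfies a tangent inequality in its own
half plane, and the concave kink lets the two be glued. -/
theorem specialFun_tangent_of_crossing {x y h k z : ℝ} (hp : 2 ≤ p) (hC : p ≤ C) (hz : 0 ≤ z)
    (hx : 0 ≤ x) (hxh : 0 ≤ x + h) (hy : 0 ≤ y) (hyk : y + k < 0) (hk : |k| ≤ |h|) :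
    specialFun p C (x + h) (y + k) z ≤
      specialFun p C x y z + derivX p C x y z * h + radialDeriv p C x y z * k := by
  have hk0 : k < 0 := by linarith
  set t := y / (-k) with ht
  have hk' : k ≠ 0 := hk0.ne
  have ht0 : 0 ≤ t := div_nonneg hy (by linarith)
  have ht1 : t ≤ 1 := by rw [ht, div_le_one (by linarith)]; linarith
  have hyt : y = -(t * k) := by rw [ht]; field_simp
  have hxt : 0 ≤ x + t * h := by nlinarith
  have habs : ∀ c, 0 ≤ c → |c * k| ≤ |c * h| := fun c hc => by
    rw [abs_mul, abs_mul]; exact mul_le_mul_of_nonneg_left hk (abs_nonneg c)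
  have hq := radialDeriv_zero_nonpos hp hC hz hxt
  -- Beyond the crossing the segment is reflected into 0 ≤ y, which U does not notice.
  have out : specialFun p C (x + h) (y + k) z ≤ specialFun p C (x + t * h) 0 z
      + derivX p C (x + t * h) 0 z * ((1 - t) * h)
      + radialDeriv p C (x + t * h) 0 z * (-((1 - t) * k)) := by
    have := specialFun_tangent_of_nonneg (x := x + t * h) (y := 0) (h := (1 - t) * h)
      (k := -((1 - t) * k)) hp hC hz hxt (by linarith) le_rfl (by nlinarith)
      (by rw [abs_neg]; exact habs _ (by linarith))
    rw [← specialFun_neg (x + h) (y + k)]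
    convert this using 2
    · ring
    · rw [hyt]; ring
  have back : specialFun p C x y z ≤ specialFun p C (x + t * h) 0 z
      + derivX p C (x + t * h) 0 z * (-(t * h))
      + radialDeriv p C (x + t * h) 0 z * (-(t * k)) := by
    have := specialFun_tangent_of_nonneg (x := x + t * h) (y := 0) (h := -(t * h))
      (k := -(t * k)) hp hC hz hxt (by linarith) le_rfl (by linarith)
      (by rw [abs_neg, abs_neg]; exact habs _ ht0)
    convert this using 2
    · ring
    · rw [hyt]; ring
  have forth : specialFun p C (x + t * h) 0 z ≤ specialFun p C x y z
      + derivX p C x y z * (t * h) + radialDeriv p C x y z * (t * k) := by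
    have := specialFun_tangent_of_nonneg (x := x) (y := y) (h := t * h)
      (k := t * k) hp hC hz hx hxt hy (by linarith) (habs _ ht0)
    convert this using 2
    rw [hyt]; ring
  have hqk : 0 ≤ radialDeriv p C (x + t * h) 0 z * k := mul_nonneg_of_nonpos_of_nonpos hq hk0.le
  rcases ht0.eq_or_lt with h0 | h0
  · have hxt' : x + t * h = x := by rw [← h0]; ring
    have hy0 : y = 0 := by rw [hyt, ← h0]; ring
    rw [hxt', ← h0] at out
    rw [hxt'] at hqk
    rw [hy0] at out ⊢
    linarith
  · set S := derivX p C (x + t * h) 0 z * h with hS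
    set T := derivX p C x y z * h + radialDeriv p C x y z * k with hT
    set Q := radialDeriv p C (x + t * h) 0 z * k with hQ
    have b1 : specialFun p C x y z ≤ specialFun p C (x + t * h) 0 z - t * S - t * Q := by
      rw [hS, hQ]; linarith
    have f1 : specialFun p C (x + t * h) 0 z ≤ specialFun p C x y z + t * T := by
      rw [hT]; linarith
    have o1 : specialFun p C (x + h) (y + k) z ≤ specialFun p C (x + t * h) 0 z
        + (1 - t) * S - (1 - t) * Q := by
      rw [hS, hQ]; linarith
    -- Adding the tangent inequalities in both directions between the start and the crossing shows
    -- that the slope decreases along the segment. This needs t > 0.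
    have hST : S + Q ≤ T := by
      have : t * (S + Q) ≤ t * T := by linarith
      exact le_of_mul_le_mul_left this h0
    have : (1 - t) * (S - Q) ≤ (1 - t) * T :=
      mul_le_mul_of_nonneg_left (by linarith) (by linarith)
    linarith

/-- Concavity of the special function in the directions `(h, k)` with `|k| ≤ |h|`. -/
theorem specialFun_tangent {x y h k z : ℝ} (hp : 2 ≤ p) (hC : p ≤ C) (hz : 0 ≤ z)
    (hx : 0 ≤ x) (hxh : 0 ≤ x + h) (hk : |k| ≤ |h|) :
    specialFun p C (x + h) (y + k) z ≤
      specialFun p C x y z + derivX p C x y z * h + derivY p C x y z * k := by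
  have key : ∀ y k, 0 ≤ y → |k| ≤ |h| → specialFun p C (x + h) (y + k) z ≤
      specialFun p C x y z + derivX p C x y z * h + radialDeriv p C x y z * k := by
    intro y k hy hk
    rcases le_or_gt 0 (y + k) with h0 | h0
    · exact specialFun_tangent_of_nonneg hp hC hz hx hxh hy h0 hk
    · exact specialFun_tangent_of_crossing hp hC hz hx hxh hy h0 hk
  by_cases hy : 0 ≤ y
  · simpa only [derivY, if_pos hy] using key y k hy hk
  · have := key (-y) (-k) (by linarith) (by rwa [abs_neg])
    rw [← neg_add, specialFun_neg, specialFun_neg] at this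
    simp only [derivY, if_neg hy]
    simp only [derivX, radialDeriv, abs_neg] at this ⊢
    linarith

/-- On `z ≤ |y|` the special function decreases in `z`. -/
theorem specialFun_max_le {x y z : ℝ} (hp : 2 ≤ p) (hC : p ≤ C) (hz : 0 ≤ z) (hx : 0 ≤ x) :
    specialFun p C x y (max z |y|) ≤ specialFun p C x y z := by
  rcases le_total |y| z with h | h
  · rw [max_eq_left h]
  · rw [max_eq_right h]
    set w := |y| with hw
    have hw0 : 0 ≤ w := abs_nonneg y
    have hp1 : p - 1 ≠ 0 := by linarith
    have c1 : cutoff p C z ≤ x + w := (cutoff_le hp hC hz).trans (by linarith)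
    have c2 : cutoff p C w ≤ x + w := (cutoff_le hp hC hw0).trans (by linarith)
    unfold specialFun
    rw [← hw, axisVal_of_le hp hC hz c1, axisVal_of_le hp hC hw0 c2, slopeVal_of_le hp hC hz c1,
      slopeVal_of_le hp hC hw0 c2]
    -- Since r - x = |y|, the z-dependent part of U is C/(p - 1) times (p - 1)z^p - p z^(p-1)|y|, so
    -- the claim is this tangent inequality.
    have hT := rpow_tangent_le (q := p) (by linarith) hw0 hz
    have e1 := rpow_eq_rpow_pred_mul hp hz
    have e2 := rpow_eq_rpow_pred_mul hp hw0
    rw [e1, e2] at hT ⊢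
    have hc : 0 ≤ C / (p - 1) := div_nonneg (by linarith) (by linarith)
    have h1 := mul_le_mul_of_nonneg_left hT hc
    have h2 : C = C / (p - 1) * (p - 1) := by field_simp
    have h3 : p * C / (p - 1) = C / (p - 1) * p := by ring
    rw [h3]
    set K := C / (p - 1) with hK
    rw [h2]
    nlinarith

/-- The special function decreases along the drift. -/
theorem derivX_add_mul_abs_derivY_nonpos {α x y z : ℝ} (hp : 2 ≤ p) (hα0 : 0 ≤ α) (hα1 : α ≤ 1)
    (hC : C = (α + 1) * p) (hz : 0 ≤ z) (hx : 0 ≤ x) (hy : |y| ≤ z) :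
    derivX p C x y z + α * |derivY p C x y z| ≤ 0 := by
  have hpC : p ≤ C := by rw [hC]; nlinarith
  have habs : |derivY p C x y z| = |radialDeriv p C x y z| := by
    unfold derivY; split_ifs <;> simp
  rw [habs]
  have hG : 0 ≤ slopeVal p C z (x + |y|) := slopeVal_nonneg hp hpC
  unfold derivX
  rcases le_total (radialDeriv p C x y z) 0 with hq | hq
  · rw [abs_of_nonpos hq]; nlinarith
  · rw [abs_of_nonneg hq]
    have hr : 0 ≤ x + |y| := add_nonneg hx (abs_nonneg y)
    have hxr : x + |y| - z ≤ x := by linarith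
    unfold radialDeriv
    set r := x + |y| with hrdef
    have hG' := slopeDeriv_nonneg (z := z) hp hpC hr
    have hD := pred_mul_leadCoeff (C := C) hp
    have hp1 : 0 < p - 1 := by linarith
    have hZ : 0 ≤ z ^ (p - 1) := Real.rpow_nonneg hz _
    suffices h : (1 + α) * axisDeriv p C z r ≤
        slopeVal p C z r + (1 + α) * (x * slopeDeriv p C z r) by linarith
    rcases le_or_gt r (cutoff p C z) with h | h
    · have : axisDeriv p C z r = 0 := by
        unfold axisDeriv; rw [max_eq_right h]; ring
      rw [this]
      have : 0 ≤ (1 + α) * (x * slopeDeriv p C z r) :=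
        mul_nonneg (by linarith) (mul_nonneg hx hG')
      linarith
    · rw [axisDeriv_of_le hp hpC hz h.le, slopeVal_of_le hp hpC hz h.le]
      have hα : 1 + α = C / p := by rw [hC]; field_simp; ring
      have hL : leadCoeff p C = (p * (p - 1) + C) / (p - 1) := by
        rw [← hD]; field_simp
      -- The relation C = (α + 1)p is what makes the coefficients of z^(p-1) and r^(p-1) opposite.
      have hmul : p ^ 2 * C / (p - 1) * r ^ (p - 1) - p * C / (p - 1) * z ^ (p - 1)
          - (1 + α) * (p * leadCoeff p C * r ^ (p - 1) - p * C / (p - 1) * z ^ (p - 1))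
          = C * (C - p) / (p - 1) * (z ^ (p - 1) - r ^ (p - 1)) := by
        rw [hα, hL]; field_simp; ring
      have goal' : 0 ≤ C * (C - p) / (p - 1) * (z ^ (p - 1) - r ^ (p - 1))
          + (1 + α) * (x * slopeDeriv p C z r) := by
        have hcoef : 0 ≤ C * (C - p) / (p - 1) :=
          div_nonneg (mul_nonneg (by linarith) (by linarith)) hp1.le
        rcases le_total r z with hrz | hrz
        · have := Real.rpow_le_rpow hr hrz (z := p - 1) (by linarith)
          exact add_nonneg (mul_nonneg hcoef (by linarith))
            (mul_nonneg (by linarith) (mul_nonneg hx hG'))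
        -- For z ≤ r the negative term is at worst of order r^(p-2)(r - z). As |y| ≤ z gives r - z ≤
        -- x, the term with xG' absorbs it.
        · have hs : slopeDeriv p C z r = p ^ 2 * C * r ^ (p - 2) :=
            if_pos (lt_of_cutoff_lt hp hpC hz h)
          have hT := rpow_tangent_le (q := p - 1) (by linarith) hz hr
          rw [show p - 1 - 1 = p - 2 by ring] at hT
          have hrp : 0 ≤ r ^ (p - 2) := Real.rpow_nonneg hr _
          have h1 : C * (C - p) / (p - 1) * ((p - 1) * r ^ (p - 2) * (z - r))
              ≤ C * (C - p) / (p - 1) * (z ^ (p - 1) - r ^ (p - 1)) :=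
            mul_le_mul_of_nonneg_left (by linarith) hcoef
          have h2 : C * (C - p) / (p - 1) * ((p - 1) * r ^ (p - 2) * (z - r))
              = -(C * (C - p) * (r ^ (p - 2) * (r - z))) := by field_simp; ring
          have h3 : (1 + α) * (x * slopeDeriv p C z r) = p * C * C * (r ^ (p - 2) * x) := by
            rw [hs, hα]; field_simp
          rw [h3]
          have h4 : r ^ (p - 2) * (r - z) ≤ r ^ (p - 2) * x :=
            mul_le_mul_of_nonneg_left hxr hrp
          have h5 : 0 ≤ r ^ (p - 2) * (r - z) := mul_nonneg hrp (by linarith)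
          have h6 : 0 ≤ p * C * C := mul_nonneg (mul_nonneg (by linarith) (by linarith)) (by linarith)
          have h7 := mul_le_mul_of_nonneg_left h4 h6
          have h8 : C * (C - p) ≤ p * C * C := by nlinarith
          have h9 := mul_le_mul_of_nonneg_right h8 h5
          linarith
      have e : p * C / (p - 1) * (p * r ^ (p - 1) - z ^ (p - 1))
          = p ^ 2 * C / (p - 1) * r ^ (p - 1) - p * C / (p - 1) * z ^ (p - 1) := by ring
      rw [e]
      linarith

/-- The special function majorizes `z ^ p - (C * x) ^ p`. -/
theorem le_specialFun {x y z : ℝ} (hp : 2 ≤ p) (hC : p ≤ C) (hz : 0 ≤ z) (hx : 0 ≤ x) :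
    z ^ p - (C * x) ^ p ≤ specialFun p C x y z := by
  have hc := cutoff_nonneg hp hC hz
  have hr : 0 ≤ x + |y| := add_nonneg hx (abs_nonneg y)
  unfold specialFun
  set r := x + |y| with hrdef
  -- Raising r to the cutoff keeps F and increases G, so it only lowers U.
  set s := max r (cutoff p C z) with hs
  have hs0 : 0 ≤ s := hr.trans (le_max_left _ _)
  have hcs : cutoff p C z ≤ s := le_max_right _ _
  have hF : axisVal p C z r = axisVal p C z s := by
    unfold axisVal; rw [← hs, max_eq_left hcs]
  have hG : slopeVal p C z r ≤ slopeVal p C z s := slopeVal_mono hp hC hr (le_max_left _ _)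
  have hxG := mul_le_mul_of_nonneg_left hG hx
  rw [hF]
  refine le_trans ?_ (sub_le_sub_left hxG _)
  rw [axisVal_of_le hp hC hz hcs, slopeVal_of_le hp hC hz hcs]
  have hp1 : 0 < p - 1 := by linarith
  have hC0 : 0 ≤ C := by linarith
  have h3 := three_variable_rpow_nonneg hp hs0 (mul_nonneg hC0 hx) hz
  have hT := rpow_tangent_le (q := p) (by linarith) hs0 hz
  have hD := pred_mul_leadCoeff (C := C) hp
  have e1 := rpow_eq_rpow_pred_mul hp hz
  -- The three-variable inequality with t = Cx handles everything except C - p times the gap of a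
  -- tangent at z.
  have hY := mul_le_mul_of_nonneg_left hT (by linarith : 0 ≤ C - p)
  refine le_of_mul_le_mul_left ?_ hp1
  have lhs : (p - 1) * (leadCoeff p C * s ^ p - p * C / (p - 1) * z ^ (p - 1) * s + C * z ^ p
      - x * (p * C / (p - 1) * (p * s ^ (p - 1) - z ^ (p - 1)))) =
      (p * (p - 1) + C) * s ^ p - p * C * z ^ (p - 1) * s + (p - 1) * C * z ^ p
      - x * (p * C * (p * s ^ (p - 1) - z ^ (p - 1))) := by
    rw [← hD]; field_simp
  rw [lhs]
  rw [e1] at hY h3 ⊢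
  nlinarith

theorem specialFun_initial_nonpos {x y : ℝ} (hp : 2 ≤ p) (hC : p ≤ C) (hxy : |y| ≤ x) :
    specialFun p C x y |y| ≤ 0 := by
  set z := |y| with hzdef
  have hz : 0 ≤ z := abs_nonneg y
  have hx : 0 ≤ x := hz.trans hxy
  have hp1 : 0 < p - 1 := by linarith
  have hc : cutoff p C z ≤ x + z := (cutoff_le hp hC hz).trans (by linarith)
  unfold specialFun
  rw [← hzdef, axisVal_of_le hp hC hz hc, slopeVal_of_le hp hC hz hc]
  have hr : 0 ≤ x + z := by linarith
  rw [rpow_eq_rpow_pred_mul hp hr, rpow_eq_rpow_pred_mul hp hz]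
  have hR : 0 ≤ (x + z) ^ (p - 1) := Real.rpow_nonneg hr _
  have hZ : 0 ≤ z ^ (p - 1) := Real.rpow_nonneg hz _
  have hD := pred_mul_leadCoeff (C := C) hp
  refine nonpos_of_mul_nonpos_right ?_ hp1
  have e : (p - 1) * (leadCoeff p C * ((x + z) ^ (p - 1) * (x + z))
      - p * C / (p - 1) * z ^ (p - 1) * (x + z) + C * (z ^ (p - 1) * z)
      - x * (p * C / (p - 1) * (p * (x + z) ^ (p - 1) - z ^ (p - 1)))) =
      (x + z) ^ (p - 1) * ((p * (p - 1) + C) * (x + z) - p ^ 2 * C * x)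
      - C * (z ^ (p - 1) * z) := by
    rw [← hD]; field_simp; ring
  rw [e]
  have h1 : (p * (p - 1) + C) * (x + z) ≤ (p * (p - 1) + C) * (2 * x) :=
    mul_le_mul_of_nonneg_left (by linarith) (by nlinarith)
  have h2 : (p * (p - 1) + C) * 2 ≤ p ^ 2 * C := by
    have h3 : 0 ≤ (C - p) * (p ^ 2 - 2) := mul_nonneg (by linarith) (by nlinarith)
    have h4 : 0 ≤ p * (p * (p - 2)) := mul_nonneg (by linarith) (mul_nonneg (by linarith) (by linarith))
    nlinarith
  have h3 : (p * (p - 1) + C) * (x + z) - p ^ 2 * C * x ≤ 0 := by nlinarith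
  have h4 : (x + z) ^ (p - 1) * ((p * (p - 1) + C) * (x + z) - p ^ 2 * C * x) ≤ 0 :=
    mul_nonpos_of_nonneg_of_nonpos hR h3
  have h5 : 0 ≤ C * (z ^ (p - 1) * z) := mul_nonneg (by linarith) (mul_nonneg hZ hz)
  linarith

end SpecialFunction

/-! ### Growth of the derivatives -/

section Bounds

variable {p C : ℝ}

/-- Growth of order r^(p-1) is what makes the products of the derivatives with increments in L^p
integrable. -/
theorem mul_slopeDeriv_le {x r z : ℝ} (hp : 2 ≤ p) (hC : p ≤ C) (hz : 0 ≤ z) (hr : 0 ≤ r)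
    (hx : x ≤ r) : x * slopeDeriv p C z r ≤ p ^ 2 * C * r ^ (p - 1) := by
  unfold slopeDeriv
  split_ifs with h
  · have hr0 : 0 < r := by
      refine hr.lt_of_ne fun h0 => ?_
      rw [← h0, Real.zero_rpow (by linarith), mul_zero] at h
      exact absurd (Real.rpow_nonneg hz (p - 1)) (by linarith)
    rw [rpow_pred_eq hr0]
    have : 0 ≤ p ^ 2 * C * r ^ (p - 2) :=
      mul_nonneg (mul_nonneg (sq_nonneg p) (by linarith)) (Real.rpow_nonneg hr _)
    nlinarith
  · rw [mul_zero]
    exact mul_nonneg (mul_nonneg (sq_nonneg p) (by linarith)) (Real.rpow_nonneg hr _)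

theorem abs_radialDeriv_le {x y z : ℝ} (hp : 2 ≤ p) (hC : p ≤ C) (hz : 0 ≤ z) (hx : 0 ≤ x) :
    |radialDeriv p C x y z| ≤ p ^ 2 * C * (x + |y|) ^ (p - 1) := by
  have hr : 0 ≤ x + |y| := add_nonneg hx (abs_nonneg y)
  have h1 := axisDeriv_le_mul_slopeDeriv hp hC hz hr
  have h2 := mul_slopeDeriv_le hp hC hz hr le_rfl
  have h3 := mul_slopeDeriv_le hp hC hz hr (le_add_of_nonneg_right (abs_nonneg y) : x ≤ x + |y|)
  have h4 := axisDeriv_nonneg (r := x + |y|) hp hC hz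
  have h5 := mul_nonneg hx (slopeDeriv_nonneg (z := z) hp hC hr)
  unfold radialDeriv
  rw [abs_le]
  constructor <;> linarith

theorem abs_derivY_le {x y z : ℝ} (hp : 2 ≤ p) (hC : p ≤ C) (hz : 0 ≤ z) (hx : 0 ≤ x) :
    |derivY p C x y z| ≤ p ^ 2 * C * (x + |y|) ^ (p - 1) := by
  have := abs_radialDeriv_le (y := y) hp hC hz hx
  unfold derivY
  split_ifs
  · exact this
  · rwa [abs_neg]

theorem abs_derivX_le {x y z : ℝ} (hp : 2 ≤ p) (hC : p ≤ C) (hz : 0 ≤ z) (hx : 0 ≤ x) :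
    |derivX p C x y z| ≤ 2 * (p ^ 2 * C) * (x + |y|) ^ (p - 1) := by
  have hr : 0 ≤ x + |y| := add_nonneg hx (abs_nonneg y)
  have h1 := abs_radialDeriv_le (y := y) hp hC hz hx
  have h2 : slopeVal p C z (x + |y|) ≤ p ^ 2 * C * (x + |y|) ^ (p - 1) := by
    have hR : 0 ≤ (x + |y|) ^ (p - 1) := Real.rpow_nonneg hr _
    have hZ : 0 ≤ z ^ (p - 1) := Real.rpow_nonneg hz _
    have h3 : max 0 (p * (x + |y|) ^ (p - 1) - z ^ (p - 1)) ≤ p * (x + |y|) ^ (p - 1) :=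
      max_le (mul_nonneg (by linarith) hR) (by linarith)
    have h4 : p * C / (p - 1) ≤ p * C :=
      div_le_self (mul_nonneg (by linarith) (by linarith)) (by linarith)
    calc slopeVal p C z (x + |y|) ≤ p * C * (p * (x + |y|) ^ (p - 1)) :=
          mul_le_mul h4 h3 (le_max_left _ _) (mul_nonneg (by linarith) (by linarith))
      _ = _ := by ring
  have h3 := slopeVal_nonneg (z := z) (r := x + |y|) hp hC
  rw [abs_le] at h1 ⊢
  unfold derivX
  constructor <;> linarith

theorem rpow_pred_mul_le {p a b : ℝ} (hp : 2 ≤ p) (ha : 0 ≤ a) (hb : 0 ≤ b) :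
    a ^ (p - 1) * b ≤ a ^ p + b ^ p := by
  have hap := Real.rpow_nonneg ha p
  have hbp := Real.rpow_nonneg hb p
  rcases le_total a b with h | h
  · have := mul_le_mul_of_nonneg_right (Real.rpow_le_rpow ha h (z := p - 1) (by linarith)) hb
    rw [← rpow_eq_rpow_pred_mul hp hb] at this
    linarith
  · have := mul_le_mul_of_nonneg_left h (Real.rpow_nonneg ha (p - 1))
    rw [← rpow_eq_rpow_pred_mul hp ha] at this
    linarith

end Bounds

/-! ### Measurability of the compositions -/

section Measurability

variable {Ω : Type*} {m : MeasurableSpace Ω} {f g s : Ω → ℝ}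

theorem measurable_radialDeriv (p C : ℝ) (hf : Measurable f) (hg : Measurable g)
    (hs : Measurable s) : Measurable fun ω => radialDeriv p C (f ω) (g ω) (s ω) := by
  have hr : Measurable fun ω => f ω + |g ω| := hf.add hg.abs
  have hc : Measurable fun ω => cutoff p C (s ω) := hs.const_mul _
  refine Measurable.sub ?_ (hf.mul ?_)
  · exact (((hr.max hc).pow_const _).sub (hc.pow_const _)).const_mul _
  · exact Measurable.ite (measurableSet_lt (hs.pow_const _) ((hr.pow_const _).const_mul _))
      ((hr.pow_const _).const_mul _) measurable_const

theorem measurable_slopeVal (p C : ℝ) (hf : Measurable f) (hg : Measurable g)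
    (hs : Measurable s) : Measurable fun ω => slopeVal p C (s ω) (f ω + |g ω|) := by
  have hr : Measurable fun ω => f ω + |g ω| := hf.add hg.abs
  exact (measurable_const.max (((hr.pow_const _).const_mul _).sub (hs.pow_const _))).const_mul _

theorem measurable_derivX (p C : ℝ) (hf : Measurable f) (hg : Measurable g)
    (hs : Measurable s) : Measurable fun ω => derivX p C (f ω) (g ω) (s ω) :=
  (measurable_radialDeriv p C hf hg hs).sub (measurable_slopeVal p C hf hg hs)

theorem measurable_derivY (p C : ℝ) (hf : Measurable f) (hg : Measurable g)
    (hs : Measurable s) : Measurable fun ω => derivY p C (f ω) (g ω) (s ω) :=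
  Measurable.ite (measurableSet_le measurable_const hg) (measurable_radialDeriv p C hf hg hs)
    (measurable_radialDeriv p C hf hg hs).neg

theorem measurable_specialFun (p C : ℝ) (hf : Measurable f) (hg : Measurable g)
    (hs : Measurable s) : Measurable fun ω => specialFun p C (f ω) (g ω) (s ω) := by
  have hr : Measurable fun ω => f ω + |g ω| := hf.add hg.abs
  have hc : Measurable fun ω => cutoff p C (s ω) := hs.const_mul _
  refine Measurable.sub ?_ (hf.mul (measurable_slopeVal p C hf hg hs))
  exact (((((hr.max hc).pow_const _).sub (((hc.pow_const _).const_mul _).mul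
    (hr.max hc))).const_mul _).add ((hs.pow_const _).const_mul _))

end Measurability

/-! ### The running maximum -/

section RunningMaximum

variable {Ω : Type*}

/-- The running maximum `max_{k ≤ n} |g k|`. -/
noncomputable def runMax (g : ℕ → Ω → ℝ) : ℕ → Ω → ℝ
  | 0 => fun ω => |g 0 ω|
  | n + 1 => fun ω => max (runMax g n ω) |g (n + 1) ω|

theorem abs_le_runMax (g : ℕ → Ω → ℝ) (n : ℕ) (ω : Ω) : |g n ω| ≤ runMax g n ω := by
  cases n with
  | zero => exact le_rfl
  | succ n => exact le_max_right _ _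

theorem runMax_nonneg (g : ℕ → Ω → ℝ) (n : ℕ) (ω : Ω) : 0 ≤ runMax g n ω :=
  (abs_nonneg _).trans (abs_le_runMax g n ω)

theorem runMax_mono (g : ℕ → Ω → ℝ) (ω : Ω) : Monotone fun n => runMax g n ω :=
  monotone_nat_of_le_succ fun _ => le_max_left _ _

theorem measurable_runMax {m : MeasurableSpace Ω} {g : ℕ → Ω → ℝ} :
    ∀ n, (∀ k ≤ n, Measurable (g k)) → Measurable (runMax g n)
  | 0, h => (h 0 le_rfl).abs
  | n + 1, h => (measurable_runMax n fun k hk => h k (hk.trans n.le_succ)).max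
      (h (n + 1) le_rfl).abs

theorem memLp_runMax {m : MeasurableSpace Ω} {P : Measure Ω} {q : ℝ≥0∞} {g : ℕ → Ω → ℝ}
    (hg : ∀ n, MemLp (g n) q P) : ∀ n, MemLp (runMax g n) q P
  | 0 => (hg 0).abs
  | n + 1 => (memLp_runMax hg n).sup (hg (n + 1)).abs

end RunningMaximum

/-! ### The maximal inequality -/

section UpperBound

variable {Ω : Type*} {m : MeasurableSpace Ω} {P : Measure Ω}
  {ℱ : Filtration ℕ m} {α p : ℝ} {f g : ℕ → Ω → ℝ}

theorem AdmissiblePair.memLp_transform (h : AdmissiblePair P ℱ α f g) {q : ℝ≥0∞}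
    (hf : ∀ n, MemLp (f n) q P) : ∀ n, MemLp (g n) q P
  | 0 => (hf 0).mono (h.integrable 0).aestronglyMeasurable (h.subordinate.1 0)
  | n + 1 => by
    have hd : MemLp (g (n + 1) - g n) q P :=
      ((hf (n + 1)).sub (hf n)).mono
        ((h.integrable (n + 1)).aestronglyMeasurable.sub (h.integrable n).aestronglyMeasurable)
        (h.subordinate.1 (n + 1))
    simpa using (h.memLp_transform hf n).add hd

theorem integrable_rpow_of_memLp {f : Ω → ℝ} (hp : 2 ≤ p) (hf : MemLp f (ENNReal.ofReal p) P) :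
    Integrable (fun ω => |f ω| ^ p) P := by
  have := hf.integrable_norm_rpow (by simpa using by linarith) ENNReal.ofReal_ne_top
  rwa [ENNReal.toReal_ofReal (by linarith)] at this

/-- Products of a function of growth `r ^ (p - 1)` with a function in `L^p`. -/
theorem integrable_mul_of_abs_le {A r d : Ω → ℝ} {K : ℝ} (hp : 2 ≤ p) (hA : Measurable A)
    (hAr : ∀ᵐ ω ∂P, |A ω| ≤ K * |r ω| ^ (p - 1)) (hK : 0 ≤ K)
    (hr : MemLp r (ENNReal.ofReal p) P) (hd : MemLp d (ENNReal.ofReal p) P) :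
    Integrable (A * d) P := by
  refine Integrable.mono' (((integrable_rpow_of_memLp hp hr).add
    (integrable_rpow_of_memLp hp hd)).const_mul K)
    (hA.aestronglyMeasurable.mul hd.aestronglyMeasurable) ?_
  filter_upwards [hAr] with ω hω
  simp only [Pi.mul_apply, Pi.add_apply, Real.norm_eq_abs, abs_mul]
  calc |A ω| * |d ω| ≤ K * |r ω| ^ (p - 1) * |d ω| :=
        mul_le_mul_of_nonneg_right hω (abs_nonneg _)
    _ = K * (|r ω| ^ (p - 1) * |d ω|) := by ring
    _ ≤ _ := mul_le_mul_of_nonneg_left (rpow_pred_mul_le hp (abs_nonneg _) (abs_nonneg _)) hK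

/-- Predictable integration against the increments of an admissible pair. -/
theorem AdmissiblePair.integral_increment_nonpos [IsFiniteMeasure P] (h : AdmissiblePair P ℱ α f g)
    {n : ℕ} {A B : Ω → ℝ} (hA : Measurable[ℱ n] A) (hB : Measurable[ℱ n] B)
    (hAd : Integrable (A * (f (n + 1) - f n)) P) (hBd : Integrable (B * (g (n + 1) - g n)) P)
    (hAB : ∀ᵐ ω ∂P, A ω + α * |B ω| ≤ 0) :
    ∫ ω, (A * (f (n + 1) - f n)) ω + (B * (g (n + 1) - g n)) ω ∂P ≤ 0 := by
  have hfi : Integrable (f (n + 1) - f n) P :=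
    (h.submartingale.2.2 (n + 1)).sub (h.submartingale.2.2 n)
  have hgi : Integrable (g (n + 1) - g n) P := (h.integrable (n + 1)).sub (h.integrable n)
  have h1 := condExp_mul_of_stronglyMeasurable_left (m := ℱ n) hA.stronglyMeasurable hAd hfi
  have h2 := condExp_mul_of_stronglyMeasurable_left (m := ℱ n) hB.stronglyMeasurable hBd hgi
  rw [integral_add hAd hBd, ← integral_condExp (ℱ.le n) (f := A * _),
    ← integral_condExp (ℱ.le n) (f := B * _), ← integral_add integrable_condExp integrable_condExp]
  refine integral_nonpos_of_ae ?_
  have h3 := h.submartingale.condExp_sub_nonneg n.le_succ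
  filter_upwards [h1, h2, h3, h.subordinate.2 n, hAB] with ω h1 h2 h3 h4 h5
  simp only [diffSeq] at h4
  rw [h1, h2]
  simp only [Pi.mul_apply, Pi.zero_apply] at h3 ⊢
  rw [abs_of_nonneg h3] at h4
  -- The conditional mean of the sum is at most A + α|B| times the nonnegative drift of f.
  have h6 : B ω * (P[g (n + 1) - g n | ℱ n]) ω ≤ |B ω| * (α * (P[f (n + 1) - f n | ℱ n]) ω) :=
    (le_abs_self _).trans (by rw [abs_mul]; exact mul_le_mul_of_nonneg_left h4 (abs_nonneg _))
  have h7 := mul_nonpos_of_nonpos_of_nonneg h5 h3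
  linarith

/-- The composition of the special function with an admissible pair is an integrable process
with nonpositive expectations. -/
theorem AdmissiblePair.integral_specialFun_nonpos [IsFiniteMeasure P] (h : AdmissiblePair P ℱ α f g)
    (hα0 : 0 ≤ α) (hα1 : α ≤ 1) (hp : 2 ≤ p) (hf : ∀ n, MemLp (f n) (ENNReal.ofReal p) P) (n : ℕ) :
    Integrable (fun ω => specialFun p ((α + 1) * p) (f n ω) (g n ω) (runMax g n ω)) P ∧
      ∫ ω, specialFun p ((α + 1) * p) (f n ω) (g n ω) (runMax g n ω) ∂P ≤ 0 := by
  set C := (α + 1) * p with hC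
  have hpC : p ≤ C := by rw [hC]; nlinarith
  have hC0 : 0 ≤ C := by linarith
  have hg := h.memLp_transform hf
  have hfm : ∀ n, Measurable[ℱ n] (f n) := fun n => (h.submartingale.1 n).measurable
  have hgm : ∀ n, Measurable[ℱ n] (g n) := fun n => (h.adapted n).measurable
  have hsm : ∀ n, Measurable[ℱ n] (runMax g n) := fun n =>
    measurable_runMax n fun k hk => (hgm k).mono (ℱ.mono hk) le_rfl
  have hUm : ∀ n, Measurable (fun ω => specialFun p C (f n ω) (g n ω) (runMax g n ω)) := fun n =>
    measurable_specialFun p C ((hfm n).mono (ℱ.le n) le_rfl) ((hgm n).mono (ℱ.le n) le_rfl)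
      ((hsm n).mono (ℱ.le n) le_rfl)
  have hlow : ∀ n, Integrable (fun ω => |runMax g n ω| ^ p - C ^ p * |f n ω| ^ p) P := fun n =>
    (integrable_rpow_of_memLp hp (memLp_runMax hg n)).sub
      ((integrable_rpow_of_memLp hp (hf n)).const_mul _)
  have hmaj : ∀ n, (fun ω => |runMax g n ω| ^ p - C ^ p * |f n ω| ^ p) ≤ᵐ[P]
      fun ω => specialFun p C (f n ω) (g n ω) (runMax g n ω) := fun n => by
    filter_upwards [h.nonneg n] with ω hω
    rw [abs_of_nonneg (runMax_nonneg g n ω), abs_of_nonneg hω, ← Real.mul_rpow hC0 hω]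
    exact le_specialFun hp hpC (runMax_nonneg g n ω) hω
  induction n with
  | zero =>
    have hup : (fun ω => specialFun p C (f 0 ω) (g 0 ω) (runMax g 0 ω)) ≤ᵐ[P] 0 := by
      filter_upwards [h.nonneg 0, h.subordinate.1 0] with ω hω h0
      simp only [diffSeq] at h0
      exact specialFun_initial_nonpos hp hpC (h0.trans_eq (abs_of_nonneg hω))
    -- Here and in the inductive step, integrability comes from squeezing U between the function it
    -- majorizes and an integrable upper bound.
    exact ⟨integrable_of_le_of_le (hUm 0).aestronglyMeasurable (hmaj 0) hup (hlow 0)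
      (integrable_zero _ _ _), integral_nonpos_of_ae hup⟩
  | succ n ih =>
    set A := fun ω => derivX p C (f n ω) (g n ω) (runMax g n ω) with hA
    set B := fun ω => derivY p C (f n ω) (g n ω) (runMax g n ω) with hB
    have hAm : Measurable[ℱ n] A := measurable_derivX p C (hfm n) (hgm n) (hsm n)
    have hBm : Measurable[ℱ n] B := measurable_derivY p C (hfm n) (hgm n) (hsm n)
    have hK : 0 ≤ p ^ 2 * C := mul_nonneg (sq_nonneg p) hC0
    have hr : MemLp (fun ω => f n ω + |g n ω|) (ENNReal.ofReal p) P := (hf n).add (hg n).abs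
    have hAd : Integrable (A * (f (n + 1) - f n)) P := by
      refine integrable_mul_of_abs_le (K := 2 * (p ^ 2 * C)) hp (hAm.mono (ℱ.le n) le_rfl) ?_
        (by linarith) hr ((hf (n + 1)).sub (hf n))
      filter_upwards [h.nonneg n] with ω hω
      rw [abs_of_nonneg (add_nonneg hω (abs_nonneg _))]
      exact abs_derivX_le hp hpC (runMax_nonneg g n ω) hω
    have hBd : Integrable (B * (g (n + 1) - g n)) P := by
      refine integrable_mul_of_abs_le (K := p ^ 2 * C) hp (hBm.mono (ℱ.le n) le_rfl) ?_
        hK hr ((hg (n + 1)).sub (hg n))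
      filter_upwards [h.nonneg n] with ω hω
      rw [abs_of_nonneg (add_nonneg hω (abs_nonneg _))]
      exact abs_derivY_le hp hpC (runMax_nonneg g n ω) hω
    have hAB : ∀ᵐ ω ∂P, A ω + α * |B ω| ≤ 0 := by
      filter_upwards [h.nonneg n] with ω hω
      exact derivX_add_mul_abs_derivY_nonpos hp hα0 hα1 hC (runMax_nonneg g n ω) hω
        (abs_le_runMax g n ω)
    have hstep : (fun ω => specialFun p C (f (n + 1) ω) (g (n + 1) ω) (runMax g (n + 1) ω)) ≤ᵐ[P]
        fun ω => specialFun p C (f n ω) (g n ω) (runMax g n ω) +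
          ((A * (f (n + 1) - f n)) ω + (B * (g (n + 1) - g n)) ω) := by
      filter_upwards [h.nonneg n, h.nonneg (n + 1), h.subordinate.1 (n + 1)] with ω h0 h1 hd
      simp only [diffSeq, Pi.sub_apply] at hd
      have hz := runMax_nonneg g n ω
      have key := specialFun_tangent (y := g n ω) (h := f (n + 1) ω - f n ω) hp hpC hz h0
        (by rwa [add_sub_cancel]) hd
      rw [add_sub_cancel, add_sub_cancel] at key
      have := specialFun_max_le (y := g (n + 1) ω) hp hpC hz h1
      simp only [Pi.mul_apply, Pi.sub_apply, runMax, hA, hB]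
      linarith
    have hinc : Integrable (fun ω => (A * (f (n + 1) - f n)) ω + (B * (g (n + 1) - g n)) ω) P :=
      hAd.add hBd
    have hint := integrable_of_le_of_le (hUm (n + 1)).aestronglyMeasurable (hmaj (n + 1)) hstep
      (hlow (n + 1)) (ih.1.add hinc)
    refine ⟨hint, (integral_mono_ae hint (ih.1.add hinc) hstep).trans ?_⟩
    have := h.integral_increment_nonpos hAm hBm hAd hBd hAB
    have e := integral_add ih.1 hinc
    simp only [Pi.add_apply] at e ⊢
    linarith [ih.2]

theorem AdmissiblePair.eLpNorm_runMax_le [IsFiniteMeasure P] (h : AdmissiblePair P ℱ α f g)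
    (hα0 : 0 ≤ α) (hα1 : α ≤ 1) (hp : 2 ≤ p) (hf : ∀ n, MemLp (f n) (ENNReal.ofReal p) P) (n : ℕ) :
    eLpNorm (runMax g n) (ENNReal.ofReal p) P ≤
      ENNReal.ofReal ((α + 1) * p) * eLpNorm (f n) (ENNReal.ofReal p) P := by
  obtain ⟨hint, hle⟩ := h.integral_specialFun_nonpos hα0 hα1 hp hf n
  set C := (α + 1) * p with hC
  have hpC : p ≤ C := by rw [hC]; nlinarith
  have hC0 : 0 ≤ C := by linarith
  have hs := memLp_runMax (h.memLp_transform hf) n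
  have hsi := integrable_rpow_of_memLp hp hs
  have hfi := integrable_rpow_of_memLp hp (hf n)
  have key : ∫ ω, |runMax g n ω| ^ p ∂P ≤ C ^ p * ∫ ω, |f n ω| ^ p ∂P := by
    have hmono := integral_mono_ae (hsi.sub (hfi.const_mul (C ^ p))) hint (by
      filter_upwards [h.nonneg n] with ω hω
      simp only [Pi.sub_apply]
      rw [abs_of_nonneg (runMax_nonneg g n ω), abs_of_nonneg hω, ← Real.mul_rpow hC0 hω]
      exact le_specialFun hp hpC (runMax_nonneg g n ω) hω)
    have e := integral_sub hsi (hfi.const_mul (C ^ p))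
    rw [integral_const_mul] at e
    simp only [Pi.sub_apply] at hmono
    linarith
  have hp0 : ENNReal.ofReal p ≠ 0 := by simpa using by linarith
  rw [hs.eLpNorm_eq_integral_rpow_norm hp0 ENNReal.ofReal_ne_top,
    (hf n).eLpNorm_eq_integral_rpow_norm hp0 ENNReal.ofReal_ne_top, ← ENNReal.ofReal_mul hC0,
    ENNReal.toReal_ofReal (by linarith)]
  refine ENNReal.ofReal_le_ofReal ?_
  simp only [Real.norm_eq_abs]
  have hI : 0 ≤ ∫ ω, |f n ω| ^ p ∂P := integral_nonneg fun ω => Real.rpow_nonneg (abs_nonneg _) _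
  calc (∫ ω, |runMax g n ω| ^ p ∂P) ^ p⁻¹ ≤ (C ^ p * ∫ ω, |f n ω| ^ p ∂P) ^ p⁻¹ :=
        Real.rpow_le_rpow (integral_nonneg fun ω => Real.rpow_nonneg (abs_nonneg _) _) key
          (inv_nonneg.2 (by linarith))
    _ = C * (∫ ω, |f n ω| ^ p ∂P) ^ p⁻¹ := by
        rw [Real.mul_rpow (Real.rpow_nonneg hC0 _) hI, Real.rpow_rpow_inv hC0 (by linarith)]

theorem maxFun_eq_iSup_runMax (g : ℕ → Ω → ℝ) (ω : Ω) :
    maxFun g ω = ⨆ n, ENNReal.ofReal (runMax g n ω) := by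
  refine le_antisymm (iSup_mono fun n => ENNReal.ofReal_le_ofReal (abs_le_runMax g n ω)) ?_
  refine iSup_le fun n => ?_
  induction n with
  | zero => exact le_iSup (fun n => ENNReal.ofReal |g n ω|) 0
  | succ n ih =>
    simp only [runMax, ENNReal.ofReal_max]
    exact max_le ih (le_iSup (fun n => ENNReal.ofReal |g n ω|) (n + 1))

/-- Monotone convergence along the increasing running maxima. -/
theorem maxNorm_le_of_eLpNorm_runMax_le {K : ℝ≥0∞} (hp : 0 < p) (hg : ∀ n, Measurable (g n))
    (h : ∀ n, eLpNorm (runMax g n) (ENNReal.ofReal p) P ≤ K) : maxNorm P p g ≤ K := by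
  have hp0 : ENNReal.ofReal p ≠ 0 := by simpa using hp
  have key : ∀ n, ∫⁻ ω, ENNReal.ofReal (runMax g n ω) ^ p ∂P ≤ K ^ p := by
    intro n
    have := h n
    rw [eLpNorm_eq_lintegral_rpow_enorm_toReal hp0 ENNReal.ofReal_ne_top,
      ENNReal.toReal_ofReal hp.le, one_div, ENNReal.rpow_inv_le_iff hp] at this
    simpa only [Real.enorm_of_nonneg (runMax_nonneg g n _)] using this
  unfold maxNorm
  rw [eLpNorm_eq_lintegral_rpow_enorm_toReal hp0 ENNReal.ofReal_ne_top,
    ENNReal.toReal_ofReal hp.le, one_div, ENNReal.rpow_inv_le_iff hp]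
  have e : ∀ ω, ‖maxFun g ω‖ₑ ^ p = ⨆ n, ENNReal.ofReal (runMax g n ω) ^ p := fun ω => by
    rw [enorm_eq_self, maxFun_eq_iSup_runMax]
    exact (ENNReal.orderIsoRpow p hp).map_iSup _
  simp_rw [e]
  rw [lintegral_iSup (fun n => (measurable_runMax n fun k _ => hg k).ennreal_ofReal.pow_const p)
    fun i j hij ω => ENNReal.rpow_le_rpow (ENNReal.ofReal_le_ofReal (runMax_mono g ω hij)) hp.le]
  exact iSup_le key

theorem processNorm_le_maxNorm (P : Measure Ω) (p : ℝ) (f : ℕ → Ω → ℝ) :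
    processNorm P p f ≤ maxNorm P p f := by
  refine iSup_le fun n => eLpNorm_mono_enorm fun ω => ?_
  rw [enorm_eq_self, Real.enorm_eq_ofReal_abs]
  exact le_iSup (fun n => ENNReal.ofReal |f n ω|) n

/-- The maximal inequality. -/
theorem AdmissiblePair.maxNorm_le [IsFiniteMeasure P] (h : AdmissiblePair P ℱ α f g)
    (hα0 : 0 ≤ α) (hα1 : α ≤ 1) (hp : 2 ≤ p) :
    maxNorm P p g ≤ ENNReal.ofReal ((α + 1) * p) * processNorm P p f := by
  have hC0 : 0 < (α + 1) * p := mul_pos (by linarith) (by linarith)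
  by_cases htop : processNorm P p f = ∞
  · rw [htop, ENNReal.mul_top (by simpa using hC0)]
    exact le_top
  · have hf : ∀ n, MemLp (f n) (ENNReal.ofReal p) P := fun n =>
      ⟨(h.submartingale.2.2 n).aestronglyMeasurable,
        (le_iSup (fun n => eLpNorm (f n) (ENNReal.ofReal p) P) n).trans_lt
          (lt_top_iff_ne_top.2 htop)⟩
    refine maxNorm_le_of_eLpNorm_runMax_le (by linarith)
      (fun n => (h.adapted n).measurable.mono (ℱ.le n) le_rfl) fun n => ?_
    exact (h.eLpNorm_runMax_le hα0 hα1 hp hf n).trans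
      (mul_le_mul_right (le_iSup (fun n => eLpNorm (f n) (ENNReal.ofReal p) P) n) _)

end UpperBound

/-! ### Intermediate values of non-atomic measures -/

section NonAtomic

variable {Ω : Type*} {m : MeasurableSpace Ω} {P : Measure Ω} [IsFiniteMeasure P]

theorem NonAtomic.exists_half (hP : NonAtomic P) {A : Set Ω} (hA : MeasurableSet A)
    (hA0 : 0 < P A) : ∃ B ⊆ A, MeasurableSet B ∧ 0 < P B ∧ P B ≤ P A / 2 := by
  obtain ⟨B, hBA, hB, hB0, hlt⟩ := hP A hA hA0
  have hadd : P B + P (A \ B) = P A := by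
    have := measure_inter_add_sdiff (μ := P) A hB
    rwa [Set.inter_eq_self_of_subset_right hBA] at this
  by_cases h : P B ≤ P A / 2
  · exact ⟨B, hBA, hB, hB0, h⟩
  · refine ⟨A \ B, Set.sdiff_subset, hA.diff hB, ?_, ?_⟩
    · rw [measure_sdiff hBA hB.nullMeasurableSet (measure_ne_top _ _)]
      exact tsub_pos_of_lt hlt
    · by_contra h'
      have := ENNReal.add_lt_add (not_le.1 h) (not_le.1 h')
      rw [ENNReal.add_halves, hadd] at this
      exact lt_irrefl _ this

theorem NonAtomic.exists_small (hP : NonAtomic P) {A : Set Ω} (hA : MeasurableSet A)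
    (hA0 : 0 < P A) {ε : ℝ≥0∞} (hε : 0 < ε) : ∃ B ⊆ A, MeasurableSet B ∧ 0 < P B ∧ P B ≤ ε := by
  have key : ∀ n : ℕ, ∃ B ⊆ A, MeasurableSet B ∧ 0 < P B ∧ (2 : ℝ≥0∞) ^ n * P B ≤ P A := by
    intro n
    induction n with
    | zero => exact ⟨A, subset_rfl, hA, hA0, by simp⟩
    | succ n ih =>
      obtain ⟨B, hBA, hB, hB0, hle⟩ := ih
      obtain ⟨B', hB', hm, h0, hle'⟩ := hP.exists_half hB hB0
      refine ⟨B', hB'.trans hBA, hm, h0, ?_⟩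
      calc (2 : ℝ≥0∞) ^ (n + 1) * P B' = 2 ^ n * (2 * P B') := by ring
        _ ≤ 2 ^ n * P B := by
          refine mul_le_mul_right ?_ _
          rw [mul_comm]
          exact ENNReal.mul_le_of_le_div hle'
        _ ≤ P A := hle
  obtain ⟨n, hn⟩ := ENNReal.exists_nat_mul_gt hε.ne' (measure_ne_top P A)
  obtain ⟨B, hBA, hB, hB0, hle⟩ := key n
  refine ⟨B, hBA, hB, hB0, ?_⟩
  by_contra h
  have h1 : (n : ℝ≥0∞) * ε ≤ 2 ^ n * P B :=
    mul_le_mul' (by exact_mod_cast Nat.lt_two_pow_self.le) (not_le.1 h).le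
  exact absurd (h1.trans hle) (not_le.2 hn)

/-- Sierpiński's theorem: a non-atomic finite measure takes all intermediate values. -/
theorem NonAtomic.exists_measure_eq (hP : NonAtomic P) {A : Set Ω} (hA : MeasurableSet A)
    {t : ℝ≥0∞} (ht : t ≤ P A) : ∃ B ⊆ A, MeasurableSet B ∧ P B = t := by
  let S := {B : Set Ω // MeasurableSet B ∧ B ⊆ A ∧ P B ≤ t}
  have step : ∀ B : S, ∃ B' : S, B.1 ⊆ B'.1 ∧ ∀ E, MeasurableSet E → E ⊆ A \ B.1 →
      P B.1 + P E ≤ t → P E ≤ 2 * P (B'.1 \ B.1) := by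
    rintro ⟨B, hB, hBA, hBt⟩
    -- Greedy exhaustion: the added set has at least half the largest measure that still fits under
    -- t.
    let 𝒞 : Set ℝ≥0∞ := {c | ∃ E, MeasurableSet E ∧ E ⊆ A \ B ∧ P B + P E ≤ t ∧ P E = c}
    obtain ⟨E, hE, hEA, hEt, hsup⟩ : ∃ E, MeasurableSet E ∧ E ⊆ A \ B ∧ P B + P E ≤ t ∧
        sSup 𝒞 ≤ 2 * P E := by
      rcases eq_or_ne (sSup 𝒞) 0 with h0 | h0
      · exact ⟨∅, MeasurableSet.empty, Set.empty_subset _, by simpa using hBt, by simp [h0]⟩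
      · have hfin : sSup 𝒞 ≠ ∞ := by
          refine ne_top_of_le_ne_top (measure_ne_top P Set.univ) (sSup_le ?_)
          rintro _ ⟨E, -, -, -, rfl⟩
          exact measure_mono (Set.subset_univ _)
        obtain ⟨_, ⟨E, hE, hEA, hEt, rfl⟩, hlt⟩ := lt_sSup_iff.1 (ENNReal.half_lt_self h0 hfin)
        refine ⟨E, hE, hEA, hEt, ?_⟩
        rw [mul_comm]
        exact (ENNReal.div_le_iff_le_mul (by simp) (by simp)).1 hlt.le
    have hdisj : Disjoint B E := Set.disjoint_left.2 fun ω h1 h2 => (hEA h2).2 h1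
    refine ⟨⟨B ∪ E, hB.union hE, Set.union_subset hBA (hEA.trans Set.sdiff_subset), ?_⟩,
      Set.subset_union_left, fun E' hE' hEA' hEt' => ?_⟩
    · rwa [measure_union hdisj hE]
    · have : (B ∪ E) \ B = E := by
        rw [Set.union_sdiff_left, sdiff_eq_left]; exact hdisj.symm
      simp only [this]
      exact (le_sSup (show P E' ∈ 𝒞 from ⟨E', hE', hEA', hEt', rfl⟩)).trans hsup
  choose next hsub hnext using step
  let seq : ℕ → S := fun n => Nat.rec ⟨∅, MeasurableSet.empty, Set.empty_subset _, by simp⟩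
    (fun _ B => next B) n
  have hmono : Monotone fun n => (seq n).1 := monotone_nat_of_le_succ fun n => hsub (seq n)
  have hUt : P (⋃ n, (seq n).1) ≤ t := by
    rw [hmono.measure_iUnion]; exact iSup_le fun n => (seq n).2.2.2
  have hUm : MeasurableSet (⋃ n, (seq n).1) := MeasurableSet.iUnion fun n => (seq n).2.1
  have hUA : (⋃ n, (seq n).1) ⊆ A := Set.iUnion_subset fun n => (seq n).2.2.1
  refine ⟨_, hUA, hUm, hUt.eq_of_not_lt fun hlt => ?_⟩
  set U := ⋃ n, (seq n).1 with hU
  have hpos : 0 < P (A \ U) := by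
    rw [measure_sdiff hUA hUm.nullMeasurableSet (measure_ne_top _ _)]
    exact tsub_pos_of_lt (hlt.trans_le ht)
  obtain ⟨E, hEA, hE, hE0, hEt⟩ := hP.exists_small (hA.diff hUm) hpos (tsub_pos_of_lt hlt)
  -- The leftover set E was admissible at every stage, so each stage gained at least half its
  -- measure, which a finite measure does not allow.
  have hgrow : ∀ n : ℕ, (n : ℝ≥0∞) * P E ≤ 2 * P (seq n).1 := by
    intro n
    induction n with
    | zero => simp
    | succ n ih =>
      have hsubU : (seq n).1 ⊆ U := Set.subset_iUnion (fun n => (seq n).1) n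
      have h1 : P E ≤ 2 * P ((seq (n + 1)).1 \ (seq n).1) := by
        refine hnext (seq n) E hE (hEA.trans (Set.sdiff_subset_sdiff_right hsubU)) ?_
        calc P (seq n).1 + P E ≤ P U + (t - P U) := add_le_add (measure_mono hsubU) hEt
          _ = t := add_tsub_cancel_of_le hlt.le
      have h2 : P (seq n).1 + P ((seq (n + 1)).1 \ (seq n).1) = P (seq (n + 1)).1 := by
        have := measure_inter_add_sdiff (μ := P) (seq (n + 1)).1 (seq n).2.1
        rwa [Set.inter_eq_self_of_subset_right (hmono n.le_succ)] at this
      rw [← h2, mul_add, Nat.cast_succ, add_mul, one_mul]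
      exact add_le_add ih h1
  obtain ⟨n, hn⟩ := ENNReal.exists_nat_mul_gt hE0.ne'
    (ENNReal.mul_ne_top ENNReal.ofNat_ne_top (measure_ne_top P Set.univ) : 2 * P Set.univ ≠ ∞)
  exact absurd ((hgrow n).trans (mul_le_mul_right (measure_mono (Set.subset_univ _)) 2))
    (not_le.2 hn)

/-- A non-atomic probability space carries truncated geometric random variables. -/
theorem NonAtomic.exists_geometric {P : Measure Ω} [IsProbabilityMeasure P] (hP : NonAtomic P)
    {s : ℝ} (hs0 : 0 ≤ s) (hs1 : s ≤ 1) (N : ℕ) :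
    ∃ τ : Ω → ℕ, Measurable τ ∧ (∀ ω, τ ω ≤ N) ∧ ∀ k ≤ N, P.real {ω | k ≤ τ ω} = s ^ k := by
  induction N with
  | zero => exact ⟨fun _ => 0, measurable_const, fun _ => le_rfl, fun k hk => by simp_all⟩
  | succ N ih =>
    obtain ⟨τ, hτ, hτN, hτs⟩ := ih
    have hA : MeasurableSet {ω | N ≤ τ ω} := measurableSet_le measurable_const hτ
    have hPA : P {ω | N ≤ τ ω} = ENNReal.ofReal (s ^ N) := by
      rw [← hτs N le_rfl, ofReal_measureReal]
    obtain ⟨B, hBA, hB, hPB⟩ := hP.exists_measure_eq hA (t := ENNReal.ofReal (s ^ (N + 1))) (by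
      rw [hPA]
      exact ENNReal.ofReal_le_ofReal (pow_le_pow_of_le_one hs0 hs1 N.le_succ))
    classical
    refine ⟨fun ω => if ω ∈ B then N + 1 else τ ω, Measurable.ite hB measurable_const hτ,
      fun ω => ?_, fun k hk => ?_⟩
    · dsimp only
      split_ifs
      · exact le_rfl
      · exact (hτN ω).trans N.le_succ
    · rcases hk.lt_or_eq with hk | rfl
      · rw [← hτs k (Nat.lt_succ_iff.1 hk)]
        congr 1
        ext ω
        simp only [Set.mem_ofPred_eq]
        split_ifs with h
        · have : N ≤ τ ω := hBA h
          exact ⟨fun _ => by omega, fun _ => hk.le⟩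
        · rfl
      · have : {ω | N + 1 ≤ if ω ∈ B then N + 1 else τ ω} = B := by
          ext ω
          simp only [Set.mem_ofPred_eq]
          split_ifs with h
          · exact ⟨fun _ => h, fun _ => le_rfl⟩
          · have := hτN ω
            exact ⟨fun h' => absurd h' (by omega), fun h' => absurd h' h⟩
        rw [this, measureReal_def, hPB, ENNReal.toReal_ofReal (pow_nonneg hs0 _)]

end NonAtomic

/-! ### The filtration that reveals the random index -/

section TailFiltration

variable {Ω : Type*} {m : MeasurableSpace Ω}

/-- The σ-algebra of the events that do not split `{j ≤ τ}`. -/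
@[reducible]
def tailAlgebra (m : MeasurableSpace Ω) (τ : Ω → ℕ) (j : ℕ) : MeasurableSpace Ω where
  MeasurableSet' D := MeasurableSet[m] D ∧ ((∀ ω, j ≤ τ ω → ω ∈ D) ∨ ∀ ω, j ≤ τ ω → ω ∉ D)
  measurableSet_empty := ⟨MeasurableSet.empty, Or.inr fun _ _ h => h⟩
  measurableSet_compl D h := ⟨h.1.compl, h.2.symm.imp (fun h ω hω => h ω hω)
    fun h ω hω h' => h' (h ω hω)⟩
  measurableSet_iUnion D h := by
    refine ⟨MeasurableSet.iUnion fun i => (h i).1, ?_⟩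
    by_cases hex : ∃ i, ∀ ω, j ≤ τ ω → ω ∈ D i
    · obtain ⟨i, hi⟩ := hex
      exact Or.inl fun ω hω => Set.mem_iUnion.2 ⟨i, hi ω hω⟩
    · refine Or.inr fun ω hω hmem => ?_
      obtain ⟨i, hi⟩ := Set.mem_iUnion.1 hmem
      rcases (h i).2 with h' | h'
      · exact hex ⟨i, h'⟩
      · exact h' ω hω hi

theorem tailAlgebra_le (τ : Ω → ℕ) (j : ℕ) : tailAlgebra m τ j ≤ m := fun _ h => h.1

/-- The filtration in which `τ` is revealed, one value at a time, at the odd times. -/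
def tailFiltration (m : MeasurableSpace Ω) (τ : Ω → ℕ) : Filtration ℕ m where
  seq n := tailAlgebra m τ ((n + 1) / 2)
  mono' i j hij D h := by
    have : (i + 1) / 2 ≤ (j + 1) / 2 := Nat.div_le_div_right (by omega)
    exact ⟨h.1, h.2.imp (fun h ω hω => h ω (this.trans hω)) fun h ω hω => h ω (this.trans hω)⟩
  le' n := tailAlgebra_le τ _

theorem measurable_tailAlgebra {τ : Ω → ℕ} (hτ : Measurable τ) {j : ℕ} {φ : ℕ → ℝ}
    (hφ : ∀ i, j ≤ i → φ i = φ j) : Measurable[tailAlgebra m τ j] fun ω => φ (τ ω) := by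
  intro S hS
  refine ⟨(measurable_from_nat.comp hτ) hS, ?_⟩
  by_cases h : φ j ∈ S
  · exact Or.inl fun ω hω => by rw [Set.mem_preimage, hφ _ hω]; exact h
  · exact Or.inr fun ω hω => by rw [Set.mem_preimage, hφ _ hω]; exact h

/-- An event of the algebra contains or misses all of {j ≤ τ}, so the integral of h over it is the
whole integral or zero. -/
theorem condExp_tailAlgebra_eq_zero {P : Measure Ω} [IsFiniteMeasure P] {τ : Ω → ℕ} {j : ℕ}
    {h : Ω → ℝ} (hint : Integrable h P) (hsupp : ∀ ω, τ ω < j → h ω = 0)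
    (h0 : ∫ ω, h ω ∂P = 0) : P[h | tailAlgebra m τ j] =ᵐ[P] 0 := by
  refine (ae_eq_condExp_of_forall_setIntegral_eq (tailAlgebra_le τ j) hint
    (fun _ _ _ => integrableOn_zero) (fun D hD _ => ?_) aestronglyMeasurable_zero).symm
  simp only [integral_zero]
  rcases hD.2 with hD | hD
  · rw [setIntegral_eq_integral_of_forall_compl_eq_zero, h0]
    exact fun ω hω => hsupp ω (not_le.1 fun h' => hω (hD ω h'))
  · rw [setIntegral_eq_zero_of_forall_eq_zero]
    exact fun ω hω => hsupp ω (not_le.1 fun h' => hD ω h' hω)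

end TailFiltration

/-! ### Functions of a bounded random index -/

section FiniteRange

variable {Ω : Type*} {m : MeasurableSpace Ω} {P : Measure Ω} [IsFiniteMeasure P]
  {τ : Ω → ℕ} {N : ℕ}

theorem integrable_comp_of_le (hτ : Measurable τ) (hN : ∀ ω, τ ω ≤ N) (φ : ℕ → ℝ) :
    Integrable (fun ω => φ (τ ω)) P := by
  refine Integrable.of_bound (measurable_from_nat.comp hτ).aestronglyMeasurable
    (∑ k ∈ Finset.range (N + 1), |φ k|) (Filter.Eventually.of_forall fun ω => ?_)
  exact Finset.single_le_sum (f := fun k => |φ k|) (fun k _ => abs_nonneg _)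
    (Finset.mem_range.2 (Nat.lt_succ_of_le (hN ω)))

theorem integral_comp_of_le (hτ : Measurable τ) (hN : ∀ ω, τ ω ≤ N) (φ : ℕ → ℝ) :
    ∫ ω, φ (τ ω) ∂P = ∑ k ∈ Finset.range (N + 1), P.real {ω | τ ω = k} * φ k := by
  have hm : ∀ k, MeasurableSet {ω | τ ω = k} := fun k => hτ (measurableSet_singleton k)
  have e : (fun ω => φ (τ ω)) = fun ω => ∑ k ∈ Finset.range (N + 1),
      {ω | τ ω = k}.indicator (fun _ => φ k) ω := by
    funext ω
    rw [Finset.sum_eq_single (τ ω)]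
    · simp
    · intro k _ hk
      exact Set.indicator_of_notMem (fun h => hk h.symm) _
    · exact fun h => absurd (Finset.mem_range.2 (Nat.lt_succ_of_le (hN ω))) h
  rw [e, integral_finsetSum _ fun k _ => (integrable_const _).indicator (hm k)]
  simp_rw [fun k => integral_indicator_const (μ := P) (φ k) (hm k), smul_eq_mul]

theorem measureReal_eq_sub (hτ : Measurable τ) (k : ℕ) :
    P.real {ω | τ ω = k} = P.real {ω | k ≤ τ ω} - P.real {ω | k + 1 ≤ τ ω} := by
  have h1 : MeasurableSet {ω | k + 1 ≤ τ ω} := measurableSet_le measurable_const hτ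
  have h2 : {ω | k ≤ τ ω} = {ω | τ ω = k} ∪ {ω | k + 1 ≤ τ ω} := by
    ext ω; simp only [Set.mem_ofPred_eq, Set.mem_union]; omega
  rw [h2, measureReal_union _ h1, add_sub_cancel_right]
  exact Set.disjoint_left.2 fun ω (h : τ ω = k) (h' : k + 1 ≤ τ ω) => by omega

end FiniteRange

/-! ### The chain and its transform -/

section Chain

/-- The process that, until the random index `i` stops it, rises from `0` to `a k` at the time
`2 * k` and jumps from there to `x k`, and stops, if `i = k`, and back to `0` otherwise. -/
def chainVal (a x : ℕ → ℝ) (n i : ℕ) : ℝ :=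
  if i < (n + 1) / 2 then x i else if Even n then a (n / 2) else 0

/-- The multipliers of the transform of the chain. -/
def chainMult (α : ℝ) (n : ℕ) : ℝ := if n = 0 then 1 else if Even n then α else -1

/-- The transform of the chain by the multipliers `chainMult α`. -/
def chainTransform (α : ℝ) (a x : ℕ → ℝ) : ℕ → ℕ → ℝ
  | 0, i => chainVal a x 0 i
  | n + 1, i => chainTransform α a x n i +
      chainMult α (n + 1) * (chainVal a x (n + 1) i - chainVal a x n i)

variable {α : ℝ} {a x : ℕ → ℝ}

theorem chainVal_even (a x : ℕ → ℝ) (k i : ℕ) :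
    chainVal a x (2 * k) i = if i < k then x i else a k := by
  unfold chainVal
  rw [show (2 * k + 1) / 2 = k by omega, if_pos (even_two_mul k), show 2 * k / 2 = k by omega]

theorem chainVal_odd (a x : ℕ → ℝ) (k i : ℕ) :
    chainVal a x (2 * k + 1) i = if i ≤ k then x i else 0 := by
  unfold chainVal
  rw [show (2 * k + 1 + 1) / 2 = k + 1 by omega, if_neg (show ¬ Even (2 * k + 1) by simp)]
  simp only [Nat.lt_succ_iff]

theorem chainVal_const {n i j : ℕ} (hj : (n + 1) / 2 ≤ j) (hi : j ≤ i) :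
    chainVal a x n i = chainVal a x n j := by
  unfold chainVal
  rw [if_neg (show ¬ i < (n + 1) / 2 by omega), if_neg (show ¬ j < (n + 1) / 2 by omega)]

theorem chainTransform_const {i j : ℕ} (hi : j ≤ i) : ∀ n, (n + 1) / 2 ≤ j →
    chainTransform α a x n i = chainTransform α a x n j
  | 0, h => chainVal_const h hi
  | n + 1, h => by
    have h' : (n + 1) / 2 ≤ j := by omega
    simp only [chainTransform]
    rw [chainTransform_const hi n h', chainVal_const h hi, chainVal_const h' hi]

theorem abs_chainMult_le (hα0 : 0 ≤ α) (hα1 : α ≤ 1) (n : ℕ) : |chainMult α n| ≤ 1 := by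
  unfold chainMult
  split_ifs
  · simp
  · rwa [abs_of_nonneg hα0]
  · simp

theorem chainVal_nonneg (ha : ∀ k, 0 ≤ a k) (hx : ∀ k, 0 ≤ x k) (n i : ℕ) :
    0 ≤ chainVal a x n i := by
  unfold chainVal
  split_ifs
  · exact hx i
  · exact ha _
  · exact le_rfl

variable {Ω : Type*} {m : MeasurableSpace Ω} {P : Measure Ω} [IsFiniteMeasure P]
  {τ : Ω → ℕ} {N : ℕ}

/-- The balance condition says exactly that the jump has mean zero, and it vanishes off {k ≤ τ}. -/
theorem condExp_chainVal_odd (hτ : Measurable τ) (hN : ∀ ω, τ ω ≤ N)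
    (hbal : ∀ k, P.real {ω | τ ω = k} * x k = P.real {ω | k ≤ τ ω} * a k) (k : ℕ) :
    P[(fun ω => chainVal a x (2 * k + 1) (τ ω) - chainVal a x (2 * k) (τ ω)) |
      tailFiltration m τ (2 * k)] =ᵐ[P] 0 := by
  have hk : (2 * k + 1) / 2 = k := by omega
  have e : (fun ω => chainVal a x (2 * k + 1) (τ ω) - chainVal a x (2 * k) (τ ω)) =
      fun ω => {ω | τ ω = k}.indicator (fun _ => x k) ω
        - {ω | k ≤ τ ω}.indicator (fun _ => a k) ω := by
    funext ω
    rw [chainVal_odd, chainVal_even]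
    simp only [Set.indicator_apply, Set.mem_ofPred_eq]
    rcases lt_trichotomy (τ ω) k with h | h | h
    · simp [h, h.le, h.ne]
    · simp [h]
    · simp [h.ne', not_le.2 h, not_lt.2 h.le, h.le]
  have h1 : MeasurableSet {ω | τ ω = k} := hτ (measurableSet_singleton k)
  have h2 : MeasurableSet {ω | k ≤ τ ω} := measurableSet_le measurable_const hτ
  refine condExp_tailAlgebra_eq_zero
    (integrable_comp_of_le hτ hN fun i => chainVal a x (2 * k + 1) i - chainVal a x (2 * k) i)
    (fun ω hω => ?_) ?_
  · rw [hk] at hω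
    rw [chainVal_odd, chainVal_even, if_pos hω.le, if_pos hω, sub_self]
  · rw [e, integral_sub ((integrable_const _).indicator h1) ((integrable_const _).indicator h2),
      integral_indicator_const _ h1, integral_indicator_const _ h2, smul_eq_mul, smul_eq_mul,
      hbal, sub_self]

theorem chainVal_even_sub_nonneg (ha : ∀ k, 0 ≤ a k) (k i : ℕ) :
    0 ≤ chainVal a x (2 * k + 1 + 1) i - chainVal a x (2 * k + 1) i := by
  rw [show 2 * k + 1 + 1 = 2 * (k + 1) by ring, chainVal_odd, chainVal_even]
  by_cases h : i ≤ k
  · rw [if_pos h, if_pos (Nat.lt_succ_of_le h), sub_self]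
  · rw [if_neg h, if_neg (by omega), sub_zero]
    exact ha _

/-- A chain with balanced jumps and its transform form an admissible pair. -/
theorem admissiblePair_chain (hα0 : 0 ≤ α) (hα1 : α ≤ 1) (hτ : Measurable τ)
    (hN : ∀ ω, τ ω ≤ N) (ha : ∀ k, 0 ≤ a k) (hx : ∀ k, 0 ≤ x k)
    (hbal : ∀ k, P.real {ω | τ ω = k} * x k = P.real {ω | k ≤ τ ω} * a k) :
    AdmissiblePair P (tailFiltration m τ) α (fun n ω => chainVal a x n (τ ω))
      (fun n ω => chainTransform α a x n (τ ω)) where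
  submartingale := by
    refine submartingale_of_condExp_sub_nonneg_nat
      (fun n => (measurable_tailAlgebra (φ := chainVal a x n) hτ
        fun i hi => chainVal_const le_rfl hi).stronglyMeasurable)
      (fun n => integrable_comp_of_le hτ hN _) fun n => ?_
    rcases Nat.even_or_odd' n with ⟨k, rfl | rfl⟩
    · exact (condExp_chainVal_odd hτ hN hbal k).symm.le
    · exact condExp_nonneg (Filter.Eventually.of_forall fun ω => chainVal_even_sub_nonneg ha k _)
  nonneg n := Filter.Eventually.of_forall fun ω => chainVal_nonneg ha hx n _
  adapted n := (measurable_tailAlgebra hτ fun i hi =>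
    chainTransform_const hi n le_rfl).stronglyMeasurable
  integrable n := integrable_comp_of_le hτ hN _
  subordinate := by
    refine ⟨fun n => Filter.Eventually.of_forall fun ω => ?_, fun n => ?_⟩
    · cases n with
      | zero => exact le_rfl
      | succ n =>
        simp only [diffSeq, Pi.sub_apply, chainTransform, add_sub_cancel_left, abs_mul]
        exact mul_le_of_le_one_left (abs_nonneg _) (abs_chainMult_le hα0 hα1 _)
    · have e : diffSeq (fun n ω => chainTransform α a x n (τ ω)) (n + 1) =
          chainMult α (n + 1) • diffSeq (fun n ω => chainVal a x n (τ ω)) (n + 1) := by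
        funext ω
        simp [diffSeq, chainTransform]
      rw [e]
      have hs := condExp_smul (μ := P) (chainMult α (n + 1))
        (diffSeq (fun n ω => chainVal a x n (τ ω)) (n + 1)) (tailFiltration m τ n)
      rcases Nat.even_or_odd' n with ⟨k, rfl | rfl⟩
      · have h0 := condExp_chainVal_odd hτ hN hbal k
        filter_upwards [hs, h0] with ω hs h0
        have h0' : (P[diffSeq (fun n ω => chainVal a x n (τ ω)) (2 * k + 1) |
          tailFiltration m τ (2 * k)]) ω = 0 := h0
        rw [hs, Pi.smul_apply, h0', smul_zero, abs_zero, mul_zero]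
      · filter_upwards [hs] with ω hs
        have hm : chainMult α (2 * k + 1 + 1) = α := by
          unfold chainMult
          rw [if_neg (by omega), if_pos ⟨k + 1, by ring⟩]
        rw [hs, hm, Pi.smul_apply, smul_eq_mul, abs_mul, abs_of_nonneg hα0]

end Chain

/-! ### The extremal chain and optimality of the constant -/

section Sharpness

/-- The heights to which the extremal chain rises. -/
noncomputable def riseHeight (δ l : ℝ) : ℕ → ℝ
  | 0 => 1 / 2
  | k + 1 => δ * l ^ k

/-- The heights at which the extremal chain stops. -/
noncomputable def exitHeight (δ l s : ℝ) (N k : ℕ) : ℝ :=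
  if k < N then riseHeight δ l k / (1 - s) else riseHeight δ l k

variable {δ l s α : ℝ} {N : ℕ}

theorem riseHeight_nonneg (hδ : 0 ≤ δ) (hl : 0 ≤ l) : ∀ k, 0 ≤ riseHeight δ l k
  | 0 => by norm_num [riseHeight]
  | k + 1 => mul_nonneg hδ (pow_nonneg hl k)

theorem riseHeight_le_exitHeight (hδ : 0 ≤ δ) (hl : 0 ≤ l) (hs0 : 0 ≤ s) (hs1 : s < 1) (k : ℕ) :
    riseHeight δ l k ≤ exitHeight δ l s N k := by
  unfold exitHeight
  split_ifs
  · exact le_div_self (riseHeight_nonneg hδ hl k) (by linarith) (by linarith)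
  · exact le_rfl

theorem exitHeight_nonneg (hδ : 0 ≤ δ) (hl : 0 ≤ l) (hs0 : 0 ≤ s) (hs1 : s < 1) (k : ℕ) :
    0 ≤ exitHeight δ l s N k :=
  (riseHeight_nonneg hδ hl k).trans (riseHeight_le_exitHeight hδ hl hs0 hs1 k)

/-- The heights increase from index 1 on, so the exit height dominates all earlier rises except
possibly the initial 1/2. -/
theorem chainVal_le_max (hδ : 0 ≤ δ) (hl : 1 ≤ l) (hs0 : 0 ≤ s) (hs1 : s < 1) (n i : ℕ) :
    chainVal (riseHeight δ l) (exitHeight δ l s N) n i ≤ max (1 / 2) (exitHeight δ l s N i) := by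
  have hl0 : 0 ≤ l := by linarith
  rcases Nat.even_or_odd' n with ⟨k, rfl | rfl⟩
  · rw [chainVal_even]
    split_ifs with h
    · exact le_max_right _ _
    · cases k with
      | zero => exact le_max_left _ _
      | succ k =>
        obtain ⟨j, rfl⟩ : ∃ j, i = j + 1 := ⟨i - 1, by omega⟩
        refine le_trans ?_ ((riseHeight_le_exitHeight hδ hl0 hs0 hs1 (j + 1)).trans
          (le_max_right _ _))
        exact mul_le_mul_of_nonneg_left (pow_le_pow_right₀ hl (by omega)) hδ
  · rw [chainVal_odd]
    split_ifs
    · exact le_max_right _ _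
    · exact le_trans (by norm_num) (le_max_left _ _)

/-- Before it stops, the transform of the extremal chain grows geometrically. -/
theorem chainTransform_riseHeight (x : ℕ → ℝ) {i : ℕ} :
    ∀ k, k + 1 ≤ i → chainTransform α (riseHeight δ (1 + (α + 1) * δ)) x (2 * k + 1) i =
      (1 + (α + 1) * δ) ^ k
  | 0, h => by
    have h0 := chainVal_even (riseHeight δ (1 + (α + 1) * δ)) x 0 i
    have h1 := chainVal_odd (riseHeight δ (1 + (α + 1) * δ)) x 0 i
    rw [if_neg (by omega)] at h0 h1
    simp only [mul_zero, zero_add] at h0 h1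
    -- The start at 1/2 and the multiplier -1 on the drop to 0 give 1/2 + 1/2 = 1.
    simp only [zero_add, chainTransform, h0, h1, chainMult, riseHeight]
    norm_num
  | k + 1, h => by
    have ih := chainTransform_riseHeight x k (by omega : k + 1 ≤ i)
    have h0 := chainVal_odd (riseHeight δ (1 + (α + 1) * δ)) x k i
    have h1 := chainVal_even (riseHeight δ (1 + (α + 1) * δ)) x (k + 1) i
    have h2 := chainVal_odd (riseHeight δ (1 + (α + 1) * δ)) x (k + 1) i
    rw [if_neg (by omega)] at h0 h1 h2
    have m1 : chainMult α (2 * k + 1 + 1) = α := by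
      unfold chainMult
      rw [if_neg (by omega), if_pos ⟨k + 1, by ring⟩]
    have m2 : chainMult α (2 * (k + 1) + 1) = -1 := by
      unfold chainMult
      rw [if_neg (by omega), if_neg (by simp)]
    have step : chainTransform α (riseHeight δ (1 + (α + 1) * δ)) x (2 * (k + 1) + 1) i =
        chainTransform α (riseHeight δ (1 + (α + 1) * δ)) x (2 * k + 1) i +
        chainMult α (2 * k + 1 + 1) *
          (chainVal (riseHeight δ (1 + (α + 1) * δ)) x (2 * (k + 1)) i
            - chainVal (riseHeight δ (1 + (α + 1) * δ)) x (2 * k + 1) i) +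
        chainMult α (2 * (k + 1) + 1) *
          (chainVal (riseHeight δ (1 + (α + 1) * δ)) x (2 * (k + 1) + 1) i
            - chainVal (riseHeight δ (1 + (α + 1) * δ)) x (2 * (k + 1)) i) := rfl
    rw [step, ih, h0, h1, h2, m1, m2, riseHeight]
    ring

/-- The exponent in s = l^(-p) is critical: the decay of the probabilities cancels the growth of the
p-th powers. -/
theorem pow_succ_mul_pow_rpow {p : ℝ} (hl : 0 < l) (hs : s = l ^ (-p)) (k : ℕ) :
    s ^ (k + 1) * (l ^ k) ^ p = s := by
  have h : l ^ p * s = 1 := by rw [hs, ← Real.rpow_add hl, add_neg_cancel, Real.rpow_zero]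
  have e : (l ^ k) ^ p = (l ^ p) ^ k := by
    rw [← Real.rpow_natCast l k, ← Real.rpow_mul hl.le, mul_comm, Real.rpow_mul hl.le,
      Real.rpow_natCast]
  rw [e, pow_succ, mul_right_comm, ← mul_pow, mul_comm s, h, one_pow, one_mul]

variable {Ω : Type*} {m : MeasurableSpace Ω} {P : Measure Ω}
  {τ : Ω → ℕ} {p : ℝ}

theorem measureReal_level_of_lt [IsFiniteMeasure P] (hτ : Measurable τ)
    (hτs : ∀ k ≤ N, P.real {ω | k ≤ τ ω} = s ^ k) {k : ℕ} (hk : k < N) :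
    P.real {ω | τ ω = k} = (1 - s) * s ^ k := by
  rw [measureReal_eq_sub hτ, hτs k hk.le, hτs (k + 1) hk]
  ring

theorem measureReal_level_of_le (hN : ∀ ω, τ ω ≤ N) {k : ℕ} (hk : N ≤ k) :
    P.real {ω | τ ω = k} = P.real {ω | k ≤ τ ω} := by
  congr 1
  ext ω
  have := hN ω
  simp only [Set.mem_ofPred_eq]
  omega

/-- Below N the chain stops with conditional probability 1 - s. At N it stops surely, so no jump is
needed. -/
theorem exitHeight_balanced [IsFiniteMeasure P] (hs1 : s < 1) (hτ : Measurable τ) (hN : ∀ ω, τ ω ≤ N)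
    (hτs : ∀ k ≤ N, P.real {ω | k ≤ τ ω} = s ^ k) (k : ℕ) :
    P.real {ω | τ ω = k} * exitHeight δ l s N k = P.real {ω | k ≤ τ ω} * riseHeight δ l k := by
  unfold exitHeight
  split_ifs with h
  · have : 1 - s ≠ 0 := by linarith
    rw [measureReal_level_of_lt hτ hτs h, hτs k h.le]
    field_simp
  · rw [measureReal_level_of_le hN (not_lt.1 h)]

/-- The `p`-th moment of the terminal value of the extremal chain. -/
theorem integral_exitHeight_rpow [IsProbabilityMeasure P] (hδ : 0 ≤ δ) (hl : 0 < l) (hs : s = l ^ (-p))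
    (hs1 : s < 1) (M : ℕ) (hτ : Measurable τ) (hN : ∀ ω, τ ω ≤ M + 1)
    (hτs : ∀ k ≤ M + 1, P.real {ω | k ≤ τ ω} = s ^ k) :
    ∫ ω, exitHeight δ l s (M + 1) (τ ω) ^ p ∂P =
      M * ((1 - s) * s * (δ / (1 - s)) ^ p) + s * δ ^ p + (1 - s) * (1 / 2 / (1 - s)) ^ p := by
  have hpow := pow_succ_mul_pow_rpow hl hs
  have hd : 0 ≤ δ / (1 - s) := div_nonneg hδ (by linarith)
  rw [integral_comp_of_le hτ hN (fun k => exitHeight δ l s (M + 1) k ^ p), Finset.sum_range_succ,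
    Finset.sum_range_succ', measureReal_level_of_le hN le_rfl, hτs (M + 1) le_rfl,
    measureReal_level_of_lt hτ hτs M.succ_pos]
  have e1 : ∀ k ∈ Finset.range M, P.real {ω | τ ω = k + 1} * exitHeight δ l s (M + 1) (k + 1) ^ p
      = (1 - s) * s * (δ / (1 - s)) ^ p := by
    intro k hk
    have hk : k + 1 < M + 1 := Nat.succ_lt_succ (Finset.mem_range.1 hk)
    rw [measureReal_level_of_lt hτ hτs hk]
    unfold exitHeight
    rw [if_pos hk, riseHeight, mul_div_right_comm, Real.mul_rpow hd (pow_nonneg hl.le k)]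
    linear_combination (1 - s) * (δ / (1 - s)) ^ p * hpow k
  rw [Finset.sum_congr rfl e1, Finset.sum_const, Finset.card_range, nsmul_eq_mul]
  have e2 : exitHeight δ l s (M + 1) (M + 1) = δ * l ^ M := by
    unfold exitHeight; rw [if_neg (lt_irrefl _), riseHeight]
  have e3 : exitHeight δ l s (M + 1) 0 = 1 / 2 / (1 - s) := by
    unfold exitHeight; rw [if_pos M.succ_pos, riseHeight]
  rw [e2, e3, Real.mul_rpow hδ (pow_nonneg hl.le M), pow_zero]
  linear_combination δ ^ p * hpow M

theorem le_integral_transform_rpow [IsProbabilityMeasure P] (hl : 0 < l) (hs : s = l ^ (-p))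
    (M : ℕ) (hτ : Measurable τ) (hN : ∀ ω, τ ω ≤ M + 1)
    (hτs : ∀ k ≤ M + 1, P.real {ω | k ≤ τ ω} = s ^ k) :
    M * ((1 - s) * s) ≤ ∫ ω, (if τ ω = 0 then 0 else l ^ (τ ω - 1)) ^ p ∂P := by
  have hpow := pow_succ_mul_pow_rpow hl hs
  have hnn : ∀ k : ℕ, 0 ≤ (if k = 0 then 0 else l ^ (k - 1)) ^ p := fun k =>
    Real.rpow_nonneg (by split_ifs; exacts [le_rfl, pow_nonneg hl.le _]) _
  rw [integral_comp_of_le hτ hN (fun k => (if k = 0 then 0 else l ^ (k - 1)) ^ p),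
    Finset.sum_range_succ, Finset.sum_range_succ']
  have e1 : ∀ k ∈ Finset.range M, P.real {ω | τ ω = k + 1} *
      (if k + 1 = 0 then 0 else l ^ (k + 1 - 1)) ^ p = (1 - s) * s := by
    intro k hk
    have hk : k + 1 < M + 1 := Nat.succ_lt_succ (Finset.mem_range.1 hk)
    rw [measureReal_level_of_lt hτ hτs hk, if_neg k.succ_ne_zero, Nat.add_sub_cancel]
    linear_combination (1 - s) * hpow k
  rw [Finset.sum_congr rfl e1, Finset.sum_const, Finset.card_range, nsmul_eq_mul]
  have h1 := mul_nonneg (measureReal_nonneg (μ := P) (s := {ω | τ ω = 0})) (hnn 0)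
  have h2 := mul_nonneg (measureReal_nonneg (μ := P) (s := {ω | τ ω = M + 1})) (hnn (M + 1))
  linarith

theorem mul_maxNorm_lt_maxNorm {f g : ℕ → Ω → ℝ} {F G : Ω → ℝ} {r : ℝ} (hp : 0 < p) (hr : 0 ≤ r)
    (hF0 : ∀ ω, 0 ≤ F ω) (hG0 : ∀ ω, 0 ≤ G ω)
    (hf : ∀ ω n, |f n ω| ^ p ≤ F ω) (hg : ∀ ω, ∃ n, G ω ≤ |g n ω| ^ p)
    (hF : Integrable F P) (hG : Integrable G P) (hlt : r ^ p * ∫ ω, F ω ∂P < ∫ ω, G ω ∂P) :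
    ENNReal.ofReal r * maxNorm P p f < maxNorm P p g := by
  have hp0 : ENNReal.ofReal p ≠ 0 := by simpa using hp
  unfold maxNorm
  rw [eLpNorm_eq_lintegral_rpow_enorm_toReal hp0 ENNReal.ofReal_ne_top,
    eLpNorm_eq_lintegral_rpow_enorm_toReal hp0 ENNReal.ofReal_ne_top,
    ENNReal.toReal_ofReal hp.le, one_div, ENNReal.lt_rpow_inv_iff hp,
    ENNReal.mul_rpow_of_nonneg _ _ hp.le, ENNReal.rpow_inv_rpow hp.ne']
  simp_rw [enorm_eq_self]
  have hfF : ∫⁻ ω, maxFun f ω ^ p ∂P ≤ ENNReal.ofReal (∫ ω, F ω ∂P) := by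
    rw [ofReal_integral_eq_lintegral_ofReal hF (Filter.Eventually.of_forall hF0)]
    refine lintegral_mono fun ω => ?_
    rw [← ENNReal.le_rpow_inv_iff hp]
    refine iSup_le fun n => ?_
    rw [ENNReal.le_rpow_inv_iff hp, ENNReal.ofReal_rpow_of_nonneg (abs_nonneg _) hp.le]
    exact ENNReal.ofReal_le_ofReal (hf ω n)
  have hgG : ENNReal.ofReal (∫ ω, G ω ∂P) ≤ ∫⁻ ω, maxFun g ω ^ p ∂P := by
    rw [ofReal_integral_eq_lintegral_ofReal hG (Filter.Eventually.of_forall hG0)]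
    refine lintegral_mono fun ω => ?_
    obtain ⟨n, hn⟩ := hg ω
    calc ENNReal.ofReal (G ω) ≤ ENNReal.ofReal (|g n ω| ^ p) := ENNReal.ofReal_le_ofReal hn
      _ = ENNReal.ofReal |g n ω| ^ p := (ENNReal.ofReal_rpow_of_nonneg (abs_nonneg _) hp.le).symm
      _ ≤ _ := ENNReal.rpow_le_rpow (le_iSup (fun n => ENNReal.ofReal |g n ω|) n) hp.le
  calc ENNReal.ofReal r ^ p * ∫⁻ ω, maxFun f ω ^ p ∂P
      ≤ ENNReal.ofReal (r ^ p) * ENNReal.ofReal (∫ ω, F ω ∂P) := by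
        rw [ENNReal.ofReal_rpow_of_nonneg hr hp.le]
        exact mul_le_mul_right hfF _
    _ = ENNReal.ofReal (r ^ p * ∫ ω, F ω ∂P) := (ENNReal.ofReal_mul (Real.rpow_nonneg hr _)).symm
    _ < ENNReal.ofReal (∫ ω, G ω ∂P) := by
        refine (ENNReal.ofReal_lt_ofReal_iff_of_nonneg ?_).2 hlt
        exact mul_nonneg (Real.rpow_nonneg hr _) (integral_nonneg hF0)
    _ ≤ _ := hgG

/-- The right-hand side, as a function of δ, vanishes at 0 and has derivative (α + 1)p there. -/
theorem exists_small_rise {r : ℝ} (hr : r < (α + 1) * p) :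
    ∃ δ : ℝ, 0 < δ ∧ r * δ < 1 - (1 + (α + 1) * δ) ^ (-p) := by
  have h1 : HasDerivAt (fun t : ℝ => 1 + (α + 1) * t) (α + 1) 0 := by
    simpa using ((hasDerivAt_id (0 : ℝ)).const_mul (α + 1)).const_add 1
  have h2 := (h1.rpow_const (p := -p) (Or.inl (by simp))).neg.tendsto_slope_zero_right
  simp only [mul_zero, add_zero, Real.one_rpow, mul_one, zero_add] at h2
  rw [mul_neg, neg_neg] at h2
  obtain ⟨δ, hδ, hδ0⟩ := ((h2.eventually (lt_mem_nhds hr)).and self_mem_nhdsWithin).exists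
  have hδ0 : 0 < δ := hδ0
  refine ⟨δ, hδ0, ?_⟩
  simp only [smul_eq_mul, Pi.neg_apply, mul_zero, add_zero, Real.one_rpow] at hδ
  rw [inv_mul_eq_div, lt_div_iff₀ hδ0] at hδ
  linarith

/-- The constant `(α + 1) * p` cannot be improved. -/
theorem NonAtomic.exists_admissiblePair [IsProbabilityMeasure P] (hP : NonAtomic P) (hα0 : 0 ≤ α) (hα1 : α ≤ 1)
    (hp : 2 ≤ p) {r : ℝ} (hr0 : 0 < r) (hr : r < (α + 1) * p) :
    ∃ (ℱ : Filtration ℕ m) (f g : ℕ → Ω → ℝ), AdmissiblePair P ℱ α f g ∧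
      ENNReal.ofReal r * maxNorm P p f < maxNorm P p g := by
  have hp0 : 0 < p := by linarith
  obtain ⟨δ, hδ, hrδ⟩ := exists_small_rise hr
  set l := 1 + (α + 1) * δ with hl
  have hl1 : 1 < l := by
    have : 0 < (α + 1) * δ := mul_pos (by linarith) hδ
    linarith
  have hl0 : 0 < l := by linarith
  obtain ⟨s, hs⟩ : ∃ s, s = l ^ (-p) := ⟨_, rfl⟩
  rw [← hs] at hrδ
  have hs0 : 0 < s := by rw [hs]; exact Real.rpow_pos_of_pos hl0 _
  have hs1 : s < 1 := by nlinarith [mul_pos hr0 hδ]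
  have hs1' : 0 < 1 - s := by linarith
  have hgap : (r * (δ / (1 - s))) ^ p < 1 := by
    refine Real.rpow_lt_one (mul_nonneg hr0.le (div_nonneg hδ.le hs1'.le)) ?_ hp0
    rw [← mul_div_assoc, div_lt_one hs1']
    exact hrδ
  rw [Real.mul_rpow hr0.le (div_nonneg hδ.le hs1'.le)] at hgap
  -- The part of the bound for the maximal function of f that does not grow with M: the initial
  -- height, the last level and level 0.
  set c₀ := (1 / 2 : ℝ) ^ p + s * δ ^ p + (1 - s) * (1 / 2 / (1 - s)) ^ p with hc₀
  have hc : 0 < (1 - s) * s * (1 - r ^ p * (δ / (1 - s)) ^ p) :=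
    mul_pos (mul_pos hs1' hs0) (by linarith)
  obtain ⟨M, hM⟩ := exists_nat_gt (r ^ p * c₀ / ((1 - s) * s * (1 - r ^ p * (δ / (1 - s)) ^ p)))
  rw [div_lt_iff₀ hc] at hM
  obtain ⟨τ, hτ, hN, hτs⟩ := hP.exists_geometric hs0.le hs1.le (M + 1)
  have ha := riseHeight_nonneg hδ.le hl0.le
  have hx := exitHeight_nonneg (N := M + 1) hδ.le hl0.le hs0.le hs1
  refine ⟨tailFiltration m τ, _, _, admissiblePair_chain hα0 hα1 hτ hN ha hx
    (exitHeight_balanced hs1 hτ hN hτs), ?_⟩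
  have hF : Integrable (fun ω => exitHeight δ l s (M + 1) (τ ω) ^ p) P :=
    integrable_comp_of_le hτ hN fun k => exitHeight δ l s (M + 1) k ^ p
  refine mul_maxNorm_lt_maxNorm (F := fun ω => (1 / 2 : ℝ) ^ p + exitHeight δ l s (M + 1) (τ ω) ^ p)
    (G := fun ω => (if τ ω = 0 then 0 else l ^ (τ ω - 1)) ^ p) hp0 hr0.le
    (fun ω => add_nonneg (Real.rpow_nonneg (by norm_num) _) (Real.rpow_nonneg (hx _) _))
    (fun ω => Real.rpow_nonneg (by split_ifs; exacts [le_rfl, pow_nonneg hl0.le _]) _)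
    (fun ω n => ?_) (fun ω => ?_) ((integrable_const _).add hF)
    (integrable_comp_of_le hτ hN fun k => (if k = 0 then 0 else l ^ (k - 1)) ^ p) ?_
  · have hnn := chainVal_nonneg ha hx n (τ ω)
    rw [abs_of_nonneg hnn]
    refine (Real.rpow_le_rpow hnn (chainVal_le_max hδ.le hl1.le hs0.le hs1 n (τ ω)) hp0.le).trans ?_
    have h1 : (0 : ℝ) ≤ (1 / 2) ^ p := Real.rpow_nonneg (by norm_num) _
    have h2 := Real.rpow_nonneg (hx (τ ω)) p
    rcases max_choice (1 / 2) (exitHeight δ l s (M + 1) (τ ω)) with h | h <;> rw [h] <;> linarith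
  · by_cases h : τ ω = 0
    · refine ⟨0, ?_⟩
      rw [if_pos h, Real.zero_rpow hp0.ne']
      exact Real.rpow_nonneg (abs_nonneg _) _
    · refine ⟨2 * (τ ω - 1) + 1, ?_⟩
      rw [if_neg h, hl, chainTransform_riseHeight _ _ (by omega), ← hl,
        abs_of_nonneg (pow_nonneg hl0.le _)]
  · have h1 := integral_exitHeight_rpow hδ.le hl0 hs hs1 M hτ hN hτs
    have h2 := le_integral_transform_rpow hl0 hs M hτ hN hτs
    rw [integral_add (integrable_const _) hF, h1, integral_const, probReal_univ, one_smul]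
    refine lt_of_lt_of_le ?_ h2
    rw [hc₀] at hM
    nlinarith

end Sharpness

end MaximalIneq

theorem theorem1p4 {Ω : Type*} [m : MeasurableSpace Ω] (P : Measure Ω) [IsProbabilityMeasure P]
    (α : ℝ) (hα0 : 0 ≤ α) (hα1 : α ≤ 1) (p : ℝ) (hp : 2 ≤ p) :
    -- the two estimates
    (∀ (ℱ : Filtration ℕ m) (f g : ℕ → Ω → ℝ), MaximalIneq.AdmissiblePair P ℱ α f g →
      MaximalIneq.maxNorm P p g ≤ ENNReal.ofReal ((α + 1) * p) * MaximalIneq.processNorm P p f ∧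
      MaximalIneq.maxNorm P p g ≤ ENNReal.ofReal ((α + 1) * p) * MaximalIneq.maxNorm P p f) ∧
    -- the constant is the best possible in each of them, on every non-atomic space
    (MaximalIneq.NonAtomic P → ∀ r : ℝ, r < (α + 1) * p →
      (∃ (ℱ : Filtration ℕ m) (f g : ℕ → Ω → ℝ), MaximalIneq.AdmissiblePair P ℱ α f g ∧
        ENNReal.ofReal r * MaximalIneq.processNorm P p f < MaximalIneq.maxNorm P p g) ∧
      (∃ (ℱ : Filtration ℕ m) (f g : ℕ → Ω → ℝ), MaximalIneq.AdmissiblePair P ℱ α f g ∧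
        ENNReal.ofReal r * MaximalIneq.maxNorm P p f < MaximalIneq.maxNorm P p g)) := by
  refine ⟨fun ℱ f g h => ?_, fun hP r hr => ?_⟩
  · have h1 := h.maxNorm_le hα0 hα1 hp
    exact ⟨h1, h1.trans (mul_le_mul_right (MaximalIneq.processNorm_le_maxNorm P p f) _)⟩
  -- The construction needs a positive constant, and 1 is still below (α + 1)p because p ≥ 2. One
  -- pair serves both claims.
  · obtain ⟨ℱ, f, g, h, hlt⟩ := hP.exists_admissiblePair hα0 hα1 hp (r := max r 1)
      (lt_max_of_lt_right one_pos) (max_lt hr (by nlinarith))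
    have hlt' : ENNReal.ofReal r * MaximalIneq.maxNorm P p f < MaximalIneq.maxNorm P p g :=
      (mul_le_mul_left (ENNReal.ofReal_le_ofReal (le_max_left _ _)) _).trans_lt hlt
    exact ⟨⟨ℱ, f, g, h, (mul_le_mul_right (MaximalIneq.processNorm_le_maxNorm P p f) _).trans_lt
      hlt'⟩, ⟨ℱ, f, g, h, hlt'⟩⟩
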